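/- Programs and strings are finite binary strings, $|x|$ is the length of $x$, and $\log$ is the binary logarithm. A prefix Turing machine has a read-only one-way input tape with an infinite binary sequence, finitely many (at least one) two-way work tapes, and a one-way write-only output tape, all semi-infinite; if it halts, the segment of the input tape that it has scanned is the program $p$ and the contents of the output tape is the output. Let $U$ be an optimal prefix Turing machine: for every prefix Turing machine $T$ there is a string $i$ such that $U(ip)=T(p)$ for all $p$. Write $U^d(p)=x$ if $U$ halts on the program $p$ within $d$ steps with output $x$. Let $K(x)=\min\{|p| : U(p)=x\}$, let $$\mathrm{ld}_b(x)=\min\{d : \exists p\; (|p|\le K(p)+b \text{ and } U^d(p)=x)\}$$ be the logical depth of $x$ at significance level $b$ (with $\min\emptyset=\infty$), let $$s(x)=\min\{d : \exists p\; (|p|= K(x) \text{ and } U^d(p)=x)\}$$ be the minimal running time of a shortest program for $x$, and let the Busy Beaver function $BB(n)$ be the maximal running time of $U$ on a halting program of length at most $n$ ($0$ if there is none). There are a constant $c\ge 1$ and a function $r:\mathbb N\to\mathbb N$ with $r(n)=O(\log n)$ such that the following hold. (1) For all sequences of strings $x_j$ and integers $b_j\ge c$, with $f(j)=\mathrm{ld}_{b_j}(x_j)$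 and $s^*(j)=s(x_j)$, $$f(j)\le s^*(j)\le BB(|x_j|+r(|x_j|))\quad\text{for all } j.$$ (2) There are infinite sequences of strings $x_j$ with $|x_{j+1}|=|x_j|+1$ and of integers $b_j\ge c$ such that $f(j)=\mathrm{ld}_{b_j}(x_j)$ has no computable upper bound (for every computable $h:\mathbb N\to\mathbb N$ there are infinitely many $j$ with $f(j)>h(j)$), while $g(j)=\mathrm{ld}_{b_j+1}(x_j)$ is bounded from above by a computable function. Hence $s^*(j)=s(x_j)$ also exceeds every computable function infinitely often, and is bounded by the Busy Beaver function as in (1). (3) There are also infinite sequences of strings $x_j$ with $|x_{j+1}|=|x_j|+1$ and of integers $b_j\ge c$ for which $f(j)=\mathrm{ld}_{b_j}(x_j)$, hence also $s^*(j)=s(x_j)$, eventually exceeds every computable function: for every computable $h:\mathbb N\to\mathbb N$, $f(j)>h(j)$ and $s^*(j)>h(j)$ for all but finitely many $j$. -/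

import Mathlib

open Filter Asymptotics

/-- Moves of the head of a two-way work tape. -/
inductive HeadMove
  | left
  | stay
  | right

/-- What a machine does in one step: its next state, whether the input head advances by one
square, what it writes on each work tape and how it moves there, and the bit (if any) that it
writes on the output tape. -/
structure StepAction (tapes : ℕ) (State Sym : Type) where
  next : State
  advance : Bool
  work : Fin tapes → Sym × HeadMove
  emit : Option Bool

/-- A (deterministic) prefix Turing machine: a read-only one-way binary input tape, a positive
finite number of two-way semi-infinite work tapes over a finite alphabet with a blank, and a
one-way write-only binary output tape. The machine halts when `delta` returns `none`. -/
structure PrefixTM where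
  tapes : ℕ
  tapes_pos : 0 < tapes
  State : Type
  Sym : Type
  finite_state : Finite State
  finite_sym : Finite Sym
  blank : Sym
  start : State
  delta : State → Bool → (Fin tapes → Sym) → Option (StepAction tapes State Sym)

/-- A semi-infinite work tape with its head: `before` lists the squares to the left of the head,
nearest first, and `after` lists the scanned square and the squares to its right; all squares
beyond the end of `after` are blank. -/
structure WorkTape (Sym : Type) where
  before : List Sym
  after : List Sym

namespace WorkTape

/-- The scanned symbol. -/
def read {Sym : Type} (blank : Sym) (t : WorkTape Sym) : Sym := t.after.headD blank

/-- Write a symbol on the scanned square, then move; on the leftmost square, a move to the left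
leaves the head where it is. -/
def act {Sym : Type} (t : WorkTape Sym) (a : Sym × HeadMove) : WorkTape Sym :=
  match a.2, t.before with
  | HeadMove.left, [] => ⟨[], a.1 :: t.after.tail⟩
  | HeadMove.left, s :: l => ⟨l, s :: a.1 :: t.after.tail⟩
  | HeadMove.stay, l => ⟨l, a.1 :: t.after.tail⟩
  | HeadMove.right, l => ⟨a.1 :: l, t.after.tail⟩

end WorkTape

namespace PrefixTM

/-- A configuration: state, position of the input head, work tapes, and output so far. -/
structure Cfg (T : PrefixTM) where
  state : T.State
  pos : ℕ
  work : Fin T.tapes → WorkTape T.Sym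
  out : List Bool

/-- At the start all heads scan the leftmost squares, and work and output tapes are empty. -/
def init (T : PrefixTM) : T.Cfg := ⟨T.start, 0, fun _ => ⟨[], []⟩, []⟩

/-- The action in a configuration, on the infinite input sequence `w`; `none` means halted. -/
def action (T : PrefixTM) (w : ℕ → Bool) (c : T.Cfg) :
    Option (StepAction T.tapes T.State T.Sym) :=
  T.delta c.state (w c.pos) (fun k => (c.work k).read T.blank)

/-- One step of the computation; a halted configuration does not change. -/
def step (T : PrefixTM) (w : ℕ → Bool) (c : T.Cfg) : T.Cfg :=
  match T.action w c with
  | none => c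
  | some a =>
    { state := a.next
      pos := if a.advance then c.pos + 1 else c.pos
      work := fun k => (c.work k).act (a.work k)
      out := c.out ++ a.emit.toList }

/-- The configuration after `d` steps. -/
def run (T : PrefixTM) (w : ℕ → Bool) (d : ℕ) : T.Cfg := (T.step w)^[d] T.init

/-- `T` halts on program `p` within `d` steps with output `y`, that is, `T^d(p) = y`. The program
is the scanned segment of the input tape: the squares `0, …, pos` at halting time. The squares
behind `p`, here filled with zeros, are not scanned, so that their contents are immaterial. -/
def HaltsWithin (T : PrefixTM) (p : List Bool) (d : ℕ) (y : List Bool) : Prop :=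
  T.action (fun k => p.getD k false) (T.run (fun k => p.getD k false) d) = none ∧
    (T.run (fun k => p.getD k false) d).pos + 1 = p.length ∧
    (T.run (fun k => p.getD k false) d).out = y

/-- `T(p) = y`. -/
def Computes (T : PrefixTM) (p y : List Bool) : Prop := ∃ d, T.HaltsWithin p d y

/-- `U` is optimal (additively optimal universal): each prefix Turing machine `T` has a code `i`
with `U(ip) = T(p)` for all `p` (one side is defined if and only if the other one is). -/
def IsOptimal (U : PrefixTM) : Prop :=
  ∀ T : PrefixTM, ∃ i : List Bool, ∀ p y : List Bool, U.Computes (i ++ p) y ↔ T.Computes p y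

/-- The prefix complexity `K(x)`: the length of a shortest program for `x`. -/
noncomputable def complexity (U : PrefixTM) (x : List Bool) : ℕ :=
  sInf {n | ∃ p : List Bool, p.length = n ∧ U.Computes p x}

/-- The logical depth of `x` at significance level `b`: the least `d` such that `U^d(p) = x` for
some `p` with `|p| ≤ K(p) + b` (`⊤` if there is none). -/
noncomputable def logicalDepth (U : PrefixTM) (b : ℕ) (x : List Bool) : ℕ∞ :=
  ⨅ d ∈ {d : ℕ | ∃ p : List Bool, p.length ≤ U.complexity p + b ∧ U.HaltsWithin p d x}, (d : ℕ∞)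

/-- The minimal running time of a shortest program for `x` (`⊤` if there is none). -/
noncomputable def shortestProgramTime (U : PrefixTM) (x : List Bool) : ℕ∞ :=
  ⨅ d ∈ {d : ℕ | ∃ p : List Bool, p.length = U.complexity x ∧ U.HaltsWithin p d x}, (d : ℕ∞)

/-- `d` is the running time of `U` on the program `p`. -/
def IsRunningTime (U : PrefixTM) (p : List Bool) (d : ℕ) : Prop :=
  IsLeast {e : ℕ | ∃ y, U.HaltsWithin p e y} d

/-- The Busy Beaver function: the maximal running time of a halting program of length at most `n`
(`0` if there is no such program). -/
noncomputable def busyBeaver (U : PrefixTM) (n : ℕ) : ℕ :=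
  sSup {d : ℕ | ∃ p : List Bool, p.length ≤ n ∧ U.IsRunningTime p d}

end PrefixTM

/-! Depth comes from counting programs. Give a program $p$ the weight $2^{-|p|}$. If the programs
for $x$ found up to some point weigh at most $2^{-w}$ in total, a Shannon–Fano code recovers each of
them from a shortest program for $x$ and $|p|-w+O(1)$ further bits, so $|p|-K(p)\ge w-K(x)-O(1)$
(`complexity_program_le`). None of them counts at a significance level below $w-K(x)-O(1)$, so the
depth at such a level exceeds the time spent. If all programs for strings of length $n$ weigh at
most $2^{-v(n)}$, averaging gives an $x$ of length $n$ whose early programs weigh at most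
$2^{-n-v(n)}$. For computable $v$ and time bound $h$ such an $x$ is found by search, hence
$K(x)=O(\log n)$ (`exists_deep`). With $v=0$, Kraft's inequality yields deep strings of every large
length at a fixed level.

For the drop, $v$ must also bound the length of a program for $x$. Enumerate the halting programs
computably and let $v(n)$ be the length of program number $n$. This program describes $n$ in a
self-delimiting way, so with $x$ appended literally it is a program for $x$ of length $n+v(n)+O(1)$,
and some program at most that long is found in computable time. Since outputs are no longer than the
number of their program, a summation over $n$ shows that the strings of length $n$ have weight at
most $2^{-v(n)}$ for infinitely many program numbers $n$ (`exists_light`). There the depth falls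
from above $h(n)$ to below a computable bound when the level grows by a constant (`exists_drop`);
induction on that constant reduces it to one (`exists_drop_one`).

Sequences that work for all computable $h$ at once come from a noncomputable choice: among the
finitely many candidates of each length, take one of maximal depth. The comparison with $s^*$ and
$BB$ rests on $K(x)\le K(p)+O(1)$ for programs $p$ of $x$, and on $K(x)\le|x|+O(\log|x|)$.

All complexity bounds need machines to be built: every partial recursive function with prefix-free
domain is computed by a prefix machine (`PrefixFree.exists_machine`), which simulates the stack
machine for partial recursive functions; conversely `U` itself is partial recursive. -/

/-! ### Simulation of the stack machine for partial recursive functions by a prefix machine. -/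

namespace StackMachine

open Turing Turing.PartrecToTM2

/-- Statements of the stack machine that evaluates partial recursive functions. -/
abbrev Stmt := TM2.Stmt (fun _ : K' => Γ') Λ' (Option Γ')

/-- The stack simulated on a work tape. -/
def stackOf : Fin 4 → K' := ![K'.main, K'.rev, K'.aux, K'.stack]

/-- The work tape that simulates a stack. -/
def tapeOf : K' → Fin 4
  | K'.main => 0
  | K'.rev => 1
  | K'.aux => 2
  | K'.stack => 3

@[simp] theorem stackOf_tapeOf (k : K') : stackOf (tapeOf k) = k := by cases k <;> rfl

/-- The stack symbol of a bit. -/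
def bitSym (b : Bool) : Γ' := cond b Γ'.bit1 Γ'.bit0

/-- Control states of the prefix machine: execution of stack machine statements (a push takes two
steps), inspection of a result, input of a bit, and output of a result. -/
inductive Control
  | start
  | run (q : Stmt) (v : Option Γ')
  | write (k : K') (a : Γ') (q : Stmt) (v : Option Γ')
  | result
  | input
  | output (o : Option Bool)

/-- Push an input bit, then call the program `c`. -/
def pushBit (c : ToPartrec.Code) (b : Bool) : Stmt :=
  TM2.Stmt.push K'.main (fun _ => bitSym b) (TM2.Stmt.goto fun _ => trNormal c Cont'.halt)

/-- Put the number with binary digits `1b` on the main stack, then call the program `c`. -/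
def pushFirst (c : ToPartrec.Code) (b : Bool) : Stmt :=
  TM2.Stmt.push K'.main (fun _ => Γ'.cons)
    (TM2.Stmt.push K'.main (fun _ => Γ'.bit1) (pushBit c b))

/-- Leave all work tapes as they are, except for one, whose scanned symbol is possibly rewritten
and whose head moves. -/
def onTape (k : K') (a : Option Γ') (m : HeadMove) (r : Fin 4 → Option Γ') :
    Fin 4 → Option Γ' × HeadMove :=
  fun j => if stackOf j = k then (a, m) else (r j, HeadMove.stay)

/-- The transition function of the prefix machine. -/
def trans (c : ToPartrec.Code) (st : Control) (b : Bool) (r : Fin 4 → Option Γ') :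
    Option (StepAction 4 Control (Option Γ')) :=
  match st with
  | .start => some ⟨.run (pushFirst c b) none, false, fun j => (r j, .stay), none⟩
  | .run (.push k f q) v =>
      some ⟨.write k (f v) q v, false, onTape k (r (tapeOf k)) .right r, none⟩
  | .run (.peek k f q) v =>
      some ⟨.run q (f v (r (tapeOf k))), false, fun j => (r j, .stay), none⟩
  | .run (.pop k f q) v =>
      some ⟨.run q (f v (r (tapeOf k))), false, onTape k (r (tapeOf k)) .left r, none⟩
  | .run (.load f q) v => some ⟨.run q (f v), false, fun j => (r j, .stay), none⟩
  | .run (.branch f q₁ q₂) v =>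
      some ⟨.run (cond (f v) q₁ q₂) v, false, fun j => (r j, .stay), none⟩
  | .run (.goto f) v => some ⟨.run (tr (f v)) v, false, fun j => (r j, .stay), none⟩
  | .run .halt _ => some ⟨.result, false, fun j => (r j, .stay), none⟩
  | .write k a q v => some ⟨.run q v, false, onTape k (some a) .stay r, none⟩
  | .result =>
      match r (tapeOf .main) with
      | some .bit1 => some ⟨.input, true, onTape .main (r (tapeOf .main)) .left r, none⟩
      | _ => some ⟨.output none, false, onTape .main (r (tapeOf .main)) .left r, none⟩
  | .input => some ⟨.run (pushBit c b) none, false, fun j => (r j, .stay), none⟩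
  | .output o =>
      match r (tapeOf .main) with
      | some .bit0 => some ⟨.output (some false), false, onTape .main (r (tapeOf .main)) .left r, o⟩
      | some .bit1 => some ⟨.output (some true), false, onTape .main (r (tapeOf .main)) .left r, o⟩
      | _ => none

/-- The statements that the prefix machine for `c` can reach. -/
def reachableStmt (c : ToPartrec.Code) : Set Stmt :=
  {q | some q ∈ TM2.stmts tr (codeSupp c Cont'.halt) ∨ ∃ b, q ∈ TM2.stmts₁ (pushFirst c b)}

/-- The control states that the prefix machine for `c` can reach. -/
def reachable (c : ToPartrec.Code) : Set Control :=
  {st | match st with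
    | .run q _ => q ∈ reachableStmt c
    | .write _ _ q _ => q ∈ reachableStmt c
    | _ => True}

/-- A prefix machine needs a finite state set, but there are infinitely many statements. The states
are therefore cut down to those that a compiled program can reach, which is finite because such a
program has finite support. -/
theorem reachableStmt_finite (c : ToPartrec.Code) : (reachableStmt c).Finite := by
  have h₁ : {q : Stmt | some q ∈ TM2.stmts tr (codeSupp c Cont'.halt)}.Finite :=
    Set.Finite.preimage (fun a _ b _ h => Option.some_injective _ h) (Finset.finite_toSet _)
  have h₂ : {q : Stmt | ∃ b, q ∈ TM2.stmts₁ (pushFirst c b)}.Finite := by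
    have : {q : Stmt | ∃ b, q ∈ TM2.stmts₁ (pushFirst c b)} =
        ⋃ b, (TM2.stmts₁ (pushFirst c b) : Set Stmt) := by ext; simp
    rw [this]
    exact Set.finite_iUnion fun b => Finset.finite_toSet _
  exact (h₁.union h₂).subset fun q hq => hq

instance : Finite K' := Finite.of_injective tapeOf fun a b h => by
  have := congrArg stackOf h
  simpa using this

theorem reachable_finite (c : ToPartrec.Code) : (reachable c).Finite := by
  have hQ := reachableStmt_finite c
  have h₁ := (hQ.prod (Set.finite_univ (α := Option Γ'))).image
    (fun x : Stmt × Option Γ' => Control.run x.1 x.2)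
  have h₂ := (((Set.finite_univ (α := K' × Γ')).prod
    (hQ.prod (Set.finite_univ (α := Option Γ'))))).image
    (fun x : (K' × Γ') × (Stmt × Option Γ') => Control.write x.1.1 x.1.2 x.2.1 x.2.2)
  have h₃ : (Set.range Control.output ∪ {.start, .result, .input}).Finite :=
    (Set.finite_range _).union (by simp)
  refine (h₁.union (h₂.union h₃)).subset ?_
  rintro (_ | ⟨q, v⟩ | ⟨k, a, q, v⟩ | _ | _ | o) h
  · simp
  · exact Or.inl ⟨(q, v), ⟨h, trivial⟩, rfl⟩
  · exact Or.inr (Or.inl ⟨((k, a), (q, v)), ⟨trivial, h, trivial⟩, rfl⟩)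
  · simp
  · simp
  · simp

theorem reachableStmt_of_mem {c : ToPartrec.Code} {q q' : Stmt} (h : q' ∈ TM2.stmts₁ q)
    (hq : q ∈ reachableStmt c) : q' ∈ reachableStmt c := by
  rcases hq with hq | ⟨b, hq⟩
  · exact Or.inl (TM2.stmts_trans h hq)
  · exact Or.inr ⟨b, TM2.stmts₁_trans hq h⟩

theorem tr_mem_reachableStmt {c : ToPartrec.Code} {l : Λ'} (h : l ∈ codeSupp c Cont'.halt) :
    tr l ∈ reachableStmt c := by
  refine Or.inl ?_
  simp only [TM2.stmts, Finset.mem_insertNone, Finset.mem_biUnion]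
  rintro q ⟨⟩
  exact ⟨l, h, TM2.stmts₁_self⟩

theorem pushFirst_mem (c : ToPartrec.Code) (b : Bool) : pushFirst c b ∈ reachableStmt c :=
  Or.inr ⟨b, TM2.stmts₁_self⟩

theorem pushBit_mem (c : ToPartrec.Code) (b : Bool) : pushBit c b ∈ reachableStmt c := by
  refine reachableStmt_of_mem ?_ (pushFirst_mem c b)
  simp [pushFirst, TM2.stmts₁, TM2.stmts₁_self]

theorem goto_supports {c : ToPartrec.Code} {f : Option Γ' → Λ'} {v : Option Γ'}
    (h : (TM2.Stmt.goto f : Stmt) ∈ reachableStmt c) : f v ∈ codeSupp c Cont'.halt := by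
  rcases h with h | ⟨b, h⟩
  · let _ : Inhabited Λ' := ⟨trNormal c Cont'.halt⟩
    exact TM2.stmts_supportsStmt (tr_supports c Cont'.halt) h v
  · have := TM2.stmts₁_supportsStmt_mono h (S := codeSupp c Cont'.halt)
      (fun _ => (tr_supports c Cont'.halt).1)
    exact this v

theorem trans_reachable {c : ToPartrec.Code} {st : Control} (hst : st ∈ reachable c) {b : Bool}
    {r : Fin 4 → Option Γ'} {a : StepAction 4 Control (Option Γ')} (h : trans c st b r = some a) :
    a.next ∈ reachable c := by
  rcases st with _ | ⟨q, v⟩ | ⟨k, x, q, v⟩ | _ | _ | o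
  · cases h; exact pushFirst_mem c b
  · rcases q with ⟨k, f, q⟩ | ⟨k, f, q⟩ | ⟨k, f, q⟩ | ⟨f, q⟩ | ⟨f, q₁, q₂⟩ | f | _
    · cases h; exact reachableStmt_of_mem (by simp [TM2.stmts₁, TM2.stmts₁_self]) hst
    · cases h; exact reachableStmt_of_mem (by simp [TM2.stmts₁, TM2.stmts₁_self]) hst
    · cases h; exact reachableStmt_of_mem (by simp [TM2.stmts₁, TM2.stmts₁_self]) hst
    · cases h; exact reachableStmt_of_mem (by simp [TM2.stmts₁, TM2.stmts₁_self]) hst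
    · cases h
      refine reachableStmt_of_mem (q := .branch f q₁ q₂) ?_ hst
      cases f v <;> simp [TM2.stmts₁, TM2.stmts₁_self]
    · cases h; exact tr_mem_reachableStmt (goto_supports hst)
    · cases h; trivial
  · cases h; exact hst
  · unfold trans at h
    dsimp only at h
    split at h <;> cases h <;> trivial
  · cases h; exact pushBit_mem c b
  · unfold trans at h
    dsimp only at h
    split at h <;> cases h <;> trivial

/-- The prefix machine that reads its input bit by bit and applies the program `c` to the number
that codes the bits read, until the result asks for output. -/
def machine (c : ToPartrec.Code) : PrefixTM where
  tapes := 4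
  tapes_pos := by norm_num
  State := {st : Control // st ∈ reachable c}
  Sym := Option Γ'
  finite_state := (reachable_finite c).to_subtype
  finite_sym := inferInstance
  blank := none
  start := ⟨.start, trivial⟩
  delta := fun st b r =>
    match h : trans c st.1 b r with
    | none => none
    | some a => some ⟨⟨a.next, trans_reachable st.2 h⟩, a.advance, a.work, a.emit⟩

/-- A work tape holds the stack `L`: the head scans the top, and the bottom is marked by a
blank. -/
def Holds (t : WorkTape (Option Γ')) (L : List Γ') : Prop :=
  t.read none :: t.before = L.map some ++ [none]

theorem Holds.read {t : WorkTape (Option Γ')} {L : List Γ'} (h : Holds t L) :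
    t.read none = L.head? := by
  cases L <;> simp_all [Holds]

theorem Holds.stay {t : WorkTape (Option Γ')} {L : List Γ'} (h : Holds t L) :
    Holds (t.act (t.read none, .stay)) L := by
  simpa [Holds, WorkTape.act, WorkTape.read] using h

/-- On the empty stack the head is on the leftmost square, where a move to the left has no effect;
this agrees with `[].tail = []`. -/
theorem Holds.pop {t : WorkTape (Option Γ')} {L : List Γ'} (h : Holds t L) :
    Holds (t.act (t.read none, .left)) L.tail := by
  rcases t with ⟨l, r⟩
  rcases L with _ | ⟨a, L⟩
  · simp only [Holds, List.map_nil, List.nil_append, List.cons.injEq] at h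
    obtain ⟨h₁, rfl⟩ := h
    simpa [Holds, WorkTape.act, WorkTape.read] using h₁
  · simp only [Holds, List.map_cons, List.cons_append, List.cons.injEq] at h
    obtain ⟨h₁, h₂⟩ := h
    rcases l with _ | ⟨s, l⟩
    · simp at h₂
    · simpa [Holds, WorkTape.act, WorkTape.read] using h₂

/-- `Holds` says nothing about squares to the right of the head, where popped symbols remain. The
write after the move overwrites such a leftover. -/
theorem Holds.push {t : WorkTape (Option Γ')} {L : List Γ'} (h : Holds t L) (a : Γ') :
    Holds ((t.act (t.read none, .right)).act (some a, .stay)) (a :: L) := by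
  simpa [Holds, WorkTape.act, WorkTape.read] using h

variable {c : ToPartrec.Code} {w : ℕ → Bool}

/-- A configuration of the prefix machine, described by its components. -/
structure IsCfg (C : (machine c).Cfg) (st : Control) (pos : ℕ)
    (t : Fin 4 → WorkTape (Option Γ')) (out : List Bool) : Prop where
  state : C.state.1 = st
  pos : C.pos = pos
  work : C.work = t
  out : C.out = out

/-- The states of `machine c` form a subtype. Projecting to `Control` reduces every later step to a
computation with `trans`. -/
theorem IsCfg.action_eq {C : (machine c).Cfg} {st : Control} {pos : ℕ}
    {t : Fin 4 → WorkTape (Option Γ')} {out : List Bool} (h : IsCfg C st pos t out) :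
    ((machine c).action w C).map (fun a => (a.next.1, a.advance, a.work, a.emit)) =
      (trans c st (w pos) fun j => (t j).read none).map
        (fun a => (a.next, a.advance, a.work, a.emit)) := by
  obtain ⟨rfl, rfl, rfl, rfl⟩ := h
  unfold PrefixTM.action
  simp only [machine]
  split <;> rename_i heq
  · exact (congrArg (Option.map _) heq.symm :)
  · refine Eq.trans ?_ (congrArg (Option.map _) heq.symm :)
    rfl

theorem IsCfg.action_none {C : (machine c).Cfg} {st : Control} {pos : ℕ}
    {t : Fin 4 → WorkTape (Option Γ')} {out : List Bool} (h : IsCfg C st pos t out)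
    (ha : trans c st (w pos) (fun j => (t j).read none) = none) :
    (machine c).action w C = none := by
  have := h.action_eq (w := w)
  rw [ha] at this
  exact Option.map_eq_none_iff.1 this

theorem IsCfg.step {C : (machine c).Cfg} {st : Control} {pos : ℕ}
    {t : Fin 4 → WorkTape (Option Γ')} {out : List Bool} (h : IsCfg C st pos t out)
    {st' : Control} {adv : Bool} {f : Fin 4 → Option Γ' × HeadMove} {o : Option Bool}
    (ha : trans c st (w pos) (fun j => (t j).read none) = some ⟨st', adv, f, o⟩) :
    IsCfg ((machine c).step w C) st' (if adv then pos + 1 else pos)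
      (fun j => (t j).act (f j)) (out ++ o.toList) := by
  have h₁ := h.action_eq (w := w)
  rw [ha] at h₁
  obtain ⟨hs, hp, ht, ho⟩ := h
  unfold PrefixTM.step
  generalize (machine c).action w C = o' at h₁ ⊢
  rcases o' with _ | a'
  · simp at h₁
  · have h₂ : (a'.next.1, a'.advance, a'.work, a'.emit) = (st', adv, f, o) := Option.some.inj h₁
    have e₂ : a'.advance = adv := congrArg (·.2.1) h₂
    have e₃ : a'.work = f := congrArg (·.2.2.1) h₂
    have e₄ : a'.emit = o := congrArg (·.2.2.2) h₂
    refine ⟨congrArg Prod.fst h₂, ?_, ?_, ?_⟩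
    · simp only [e₂, hp]
    · simp only [e₃, ht]; rfl
    · simp only [e₄, ho]

/-- A configuration of the prefix machine in which the work tapes hold the stacks `S`. -/
def Sim (C : (machine c).Cfg) (st : Control) (pos : ℕ) (S : K' → List Γ')
    (out : List Bool) : Prop :=
  ∃ t, IsCfg C st pos t out ∧ ∀ j : Fin 4, Holds (t j) (S (stackOf j))

theorem read_eq {t : Fin 4 → WorkTape (Option Γ')} {S : K' → List Γ'}
    (h : ∀ j : Fin 4, Holds (t j) (S (stackOf j))) :
    (fun j => (t j).read none) = fun j => (S (stackOf j)).head? :=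
  funext fun j => (h j).read

theorem Sim.step_stay {C : (machine c).Cfg} {st st' : Control} {pos : ℕ} {S : K' → List Γ'}
    {out : List Bool} (h : Sim C st pos S out)
    (ha : trans c st (w pos) (fun j => (S (stackOf j)).head?) =
      some ⟨st', false, fun j => ((S (stackOf j)).head?, .stay), none⟩) :
    Sim ((machine c).step w C) st' pos S out := by
  obtain ⟨t, h, hS⟩ := h
  rw [← read_eq hS] at ha
  have := h.step ha
  simp only [Bool.false_eq_true, if_false, Option.toList_none, List.append_nil] at this
  refine ⟨_, this, fun j => ?_⟩
  rw [← (hS j).read]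
  exact (hS j).stay

theorem Sim.step_pop {C : (machine c).Cfg} {st st' : Control} {pos : ℕ} {S : K' → List Γ'}
    {out : List Bool} (h : Sim C st pos S out) (k : K') {adv : Bool} {o : Option Bool}
    (ha : trans c st (w pos) (fun j => (S (stackOf j)).head?) =
      some ⟨st', adv, onTape k (S k).head? .left fun j => (S (stackOf j)).head?, o⟩) :
    Sim ((machine c).step w C) st' (if adv then pos + 1 else pos)
      (Function.update S k (S k).tail) (out ++ o.toList) := by
  obtain ⟨t, h, hS⟩ := h
  rw [← read_eq hS] at ha
  refine ⟨_, h.step ha, fun j => ?_⟩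
  simp only [onTape]
  by_cases hk : stackOf j = k
  · subst hk
    rw [if_pos rfl, Function.update_self, ← (hS j).read]
    exact (hS j).pop
  · rw [if_neg hk, Function.update_of_ne hk]
    exact (hS j).stay

theorem Sim.step_push {C : (machine c).Cfg} {k : K'} {f : Option Γ' → Γ'} {q : Stmt}
    {v : Option Γ'} {pos : ℕ} {S : K' → List Γ'} {out : List Bool}
    (h : Sim C (.run (.push k f q) v) pos S out) :
    Sim ((machine c).step w ((machine c).step w C)) (.run q v) pos
      (Function.update S k (f v :: S k)) out := by
  obtain ⟨t, h, hS⟩ := h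
  have h₁ := (h.step (w := w) rfl).step (w := w) rfl
  simp only [Bool.false_eq_true, if_false, Option.toList_none, List.append_nil] at h₁
  refine ⟨_, h₁, fun j => ?_⟩
  simp only [onTape]
  by_cases hk : stackOf j = k
  · subst hk
    have : tapeOf (stackOf j) = j := by fin_cases j <;> rfl
    rw [if_pos rfl, if_pos rfl, Function.update_self, this]
    exact (hS j).push _
  · rw [if_neg hk, if_neg hk, Function.update_of_ne hk]
    exact (hS j).stay.stay

/-- The control state in which the prefix machine continues after a stack machine step. -/
def next (C : TM2.Cfg (fun _ : K' => Γ') Λ' (Option Γ')) : Control :=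
  match C.l with
  | none => .result
  | some l => .run (tr l) C.var

theorem Sim.run_stmt (q : Stmt) : ∀ {C : (machine c).Cfg} {v : Option Γ'} {pos : ℕ}
    {S : K' → List Γ'} {out : List Bool}, Sim C (.run q v) pos S out →
    ∃ d, Sim (((machine c).step w)^[d] C) (next (TM2.stepAux q v S)) pos
      (TM2.stepAux q v S).stk out := by
  induction q with
  | push k f q ih =>
    intro C v pos S out h
    obtain ⟨d, hd⟩ := ih (h.step_push (w := w))
    exact ⟨d + 2, hd⟩
  | peek k f q ih =>
    intro C v pos S out h
    obtain ⟨d, hd⟩ := ih (h.step_stay (w := w) rfl)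
    simp only [stackOf_tapeOf] at hd
    exact ⟨d + 1, hd⟩
  | pop k f q ih =>
    intro C v pos S out h
    have h₁ := h.step_pop (w := w) k (adv := false) (o := none)
      (st' := .run q (f v (S k).head?)) (by simp only [trans, stackOf_tapeOf])
    simp only [Bool.false_eq_true, if_false, Option.toList_none, List.append_nil] at h₁
    obtain ⟨d, hd⟩ := ih h₁
    exact ⟨d + 1, hd⟩
  | load f q ih =>
    intro C v pos S out h
    obtain ⟨d, hd⟩ := ih (h.step_stay (w := w) rfl)
    exact ⟨d + 1, hd⟩
  | branch f q₁ q₂ ih₁ ih₂ =>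
    intro C v pos S out h
    have h₁ := h.step_stay (w := w) rfl
    cases hf : f v
    · rw [hf] at h₁
      obtain ⟨d, hd⟩ := ih₂ h₁
      exact ⟨d + 1, by simpa [hf] using hd⟩
    · rw [hf] at h₁
      obtain ⟨d, hd⟩ := ih₁ h₁
      exact ⟨d + 1, by simpa [hf] using hd⟩
  | goto f =>
    intro C v pos S out h
    exact ⟨1, h.step_stay (w := w) rfl⟩
  | halt =>
    intro C v pos S out h
    exact ⟨1, h.step_stay (w := w) rfl⟩

theorem Sim.run_reaches {D D' : TM2.Cfg (fun _ : K' => Γ') Λ' (Option Γ')}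
    (hD : StateTransition.Reaches (TM2.step tr) D D') {pos : ℕ} {out : List Bool}
    {C : (machine c).Cfg} (h : Sim C (next D) pos D.stk out) :
    ∃ d, Sim (((machine c).step w)^[d] C) (next D') pos D'.stk out := by
  induction hD with
  | refl => exact ⟨0, h⟩
  | @tail D₁ D₂ _ h₂ ih =>
    obtain ⟨d, hd⟩ := ih
    rcases D₁ with ⟨_ | l, v, S⟩
    · cases h₂
    · obtain ⟨d', hd'⟩ := hd.run_stmt (w := w)
      refine ⟨d' + d, ?_⟩
      rw [Function.iterate_add_apply]
      simp only [TM2.step, Option.mem_def, Option.some.injEq] at h₂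
      subst h₂
      exact hd'

/-- The stacks of the prefix machine when it holds the number `n`. -/
def numStacks (n : ℕ) : K' → List Γ' := K'.elim (trNat n ++ [Γ'.cons]) [] [] []

/-- The prefix machine applies the program `c` to the number on its main stack. -/
theorem Sim.run_code {n m : ℕ} (hm : [m] ∈ c.eval [n]) {pos : ℕ} {out : List Bool}
    {C : (machine c).Cfg} (h : Sim C (next (init c [n])) pos (numStacks n) out) :
    ∃ d, Sim (((machine c).step w)^[d] C) .result pos (numStacks m) out := by
  have h₁ : halt [m] ∈ StateTransition.eval (TM2.step tr) (init c [n]) := by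
    rw [tr_eval]
    exact (Part.mem_map_iff _).2 ⟨_, hm, rfl⟩
  exact Sim.run_reaches (StateTransition.mem_eval.1 h₁).1 h

theorem trNat_bit (b : Bool) {n : ℕ} (hn : 0 < n) : trNat (Nat.bit b n) = bitSym b :: trNat n := by
  unfold trNat
  rw [← Num.ofNat'_eq, ← Num.ofNat'_eq, Num.ofNat'_bit]
  have hn' : Num.ofNat' n ≠ 0 := by
    rw [Num.ofNat'_eq]
    intro h
    have := congrArg (fun x : Num => (x : ℕ)) h
    simp at this
    omega
  generalize Num.ofNat' n = x at hn' ⊢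
  rcases x with _ | x
  · exact absurd rfl hn'
  · cases b <;> rfl

/-- The number with binary digits, from the lowest one, `y` followed by `1`. -/
def digits : List Bool → ℕ
  | [] => 1
  | b :: y => Nat.bit b (digits y)

theorem digits_pos (y : List Bool) : 0 < digits y := by
  induction y with
  | nil => exact Nat.one_pos
  | cons b y ih => cases b <;> simp [digits, ih]

theorem trNat_digits (y : List Bool) : trNat (digits y) = y.map bitSym ++ [Γ'.bit1] := by
  induction y with
  | nil => rfl
  | cons b y ih => simp [digits, trNat_bit b (digits_pos y), ih]

theorem Sim.push_bit {n : ℕ} (hn : 0 < n) {b : Bool} {pos : ℕ} {out : List Bool}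
    {C : (machine c).Cfg} (h : Sim C (.run (pushBit c b) none) pos (numStacks n) out) :
    ∃ d, Sim (((machine c).step w)^[d] C) (next (init c [Nat.bit b n])) pos
      (numStacks (Nat.bit b n)) out := by
  have h₁ := h.step_push (w := w)
  have h₂ := h₁.step_stay (w := w) rfl
  refine ⟨3, ?_⟩
  have : numStacks (Nat.bit b n) =
      Function.update (numStacks n) K'.main (bitSym b :: numStacks n K'.main) := by
    simp [numStacks, trNat_bit b hn]
  rw [this]
  exact h₂

/-- Emission lags one pop behind: the state carries the bit popped last. The leading digit 1 is thus
left in the state and never emitted. -/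
theorem Sim.output (y : List Bool) : ∀ {o : Option Bool} {pos : ℕ} {out : List Bool}
    {C : (machine c).Cfg}, Sim C (.output o) pos (numStacks (digits y)) out →
    ∃ d, Sim (((machine c).step w)^[d] C) (.output (some true)) pos
      (K'.elim [Γ'.cons] [] [] []) (out ++ o.toList ++ y) := by
  induction y with
  | nil =>
    intro o pos out C h
    have h₁ := h.step_pop (w := w) K'.main (st' := .output (some true)) (adv := false) (o := o) rfl
    exact ⟨1, by simpa [numStacks, trNat_digits] using h₁⟩
  | cons b y ih =>
    intro o pos out C h
    have h₁ := h.step_pop (w := w) K'.main (st' := .output (some b)) (adv := false) (o := o)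
      (by cases b <;> simp [trans, numStacks, trNat_digits, bitSym])
    have e : Function.update (numStacks (digits (b :: y))) K'.main
        (numStacks (digits (b :: y)) K'.main).tail = numStacks (digits y) := by
      simp [numStacks, trNat_digits]
    rw [e] at h₁
    obtain ⟨d, hd⟩ := ih h₁
    exact ⟨d + 1, by simpa using hd⟩

/-- The prefix machine computes `y` from the program `p` if `c` asks for more input on all proper
initial segments of `p`, and for the output `y` on `p`. -/
theorem machine_computes {p y : List Bool} (hp : p ≠ [])
    (h₁ : ∀ s : List Bool, s ≠ [] → s <+: p → s ≠ p →
      [digits (true :: s.reverse)] ∈ c.eval [digits s.reverse])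
    (h₂ : [digits (false :: y)] ∈ c.eval [digits p.reverse]) :
    (machine c).Computes p y := by
  set w : ℕ → Bool := fun k => p.getD k false with hw
  have hw' : ∀ k, k < p.length → (p.take (k + 1)).reverse = w k :: (p.take k).reverse := by
    intro k hk
    rw [List.take_add_one, List.getElem?_eq_getElem hk, List.reverse_append, hw]
    simp [hk]
  -- With `k + 1` bits read, the latest one on top of the stack, the input head is still on square
  -- `k`: it advances only when the result asks for more.
  have main : ∀ k, k < p.length → ∃ d, Sim (((machine c).step w)^[d] (machine c).init)
      (next (init c [digits (p.take (k + 1)).reverse])) k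
      (numStacks (digits (p.take (k + 1)).reverse)) [] := by
    intro k
    induction k with
    | zero =>
      intro hk
      have e₀ : Sim (machine c).init .start 0 (K'.elim [] [] [] []) [] :=
        ⟨fun _ => ⟨[], []⟩, ⟨rfl, rfl, rfl, rfl⟩, fun j => by fin_cases j <;> rfl⟩
      have e₁ := ((e₀.step_stay (w := w) rfl).step_push (w := w)).step_push (w := w)
      obtain ⟨d, hd⟩ := Sim.push_bit (w := w) (n := 1) one_pos (b := w 0) (by
        have e : numStacks 1 = K'.elim [Γ'.bit1, Γ'.cons] [] [] [] := by
          have := trNat_digits []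
          simp only [digits] at this
          simp [numStacks, this]
        rw [e]
        simpa using e₁)
      -- One step leaves `start`, and two pushes take two steps each.
      refine ⟨d + 5, ?_⟩
      rw [hw' 0 hk]
      exact hd
    | succ k ih =>
      intro hk
      obtain ⟨d, hd⟩ := ih (by omega)
      have hne : p.take (k + 1) ≠ [] := by
        intro h; have := congrArg List.length h; rw [List.length_take] at this; grind
      have hne' : p.take (k + 1) ≠ p := by
        intro h; have := congrArg List.length h; rw [List.length_take] at this; grind
      obtain ⟨d₂, hd₂⟩ := hd.run_code (w := w) (h₁ _ hne (List.take_prefix _ _) hne')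
      have e₁ := hd₂.step_pop (w := w) K'.main (st' := .input) (adv := true) (o := none)
        (by simp [trans, numStacks, trNat_digits, bitSym])
      have e : Function.update (numStacks (digits (true :: (p.take (k + 1)).reverse))) K'.main
          (numStacks (digits (true :: (p.take (k + 1)).reverse)) K'.main).tail =
          numStacks (digits (p.take (k + 1)).reverse) := by
        simp [numStacks, trNat_digits]
      rw [e] at e₁
      obtain ⟨d₃, hd₃⟩ := Sim.push_bit (w := w) (digits_pos _) (e₁.step_stay (w := w) rfl)
      refine ⟨d₃ + (2 + (d₂ + d)), ?_⟩
      rw [Function.iterate_add_apply, Function.iterate_add_apply, Function.iterate_add_apply,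
        hw' (k + 1) hk]
      exact hd₃
  have hlen : 0 < p.length := List.length_pos_iff.2 hp
  obtain ⟨d, hd⟩ := main (p.length - 1) (by omega)
  rw [Nat.sub_add_cancel hlen, List.take_length] at hd
  obtain ⟨d₂, hd₂⟩ := hd.run_code (w := w) h₂
  have e₁ := hd₂.step_pop (w := w) K'.main (st' := .output none) (adv := false) (o := none)
    (by simp [trans, numStacks, trNat_digits, bitSym])
  have e : Function.update (numStacks (digits (false :: y))) K'.main
      (numStacks (digits (false :: y)) K'.main).tail = numStacks (digits y) := by
    simp [numStacks, trNat_digits]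
  rw [e] at e₁
  obtain ⟨d₃, t, ht, hS⟩ := Sim.output (w := w) y e₁
  have e₂ := ht.action_none (w := w) (by rw [read_eq hS]; rfl)
  refine ⟨d₃ + (1 + (d₂ + d)), ?_⟩
  have e₃ : (machine c).run w (d₃ + (1 + (d₂ + d))) = ((machine c).step w)^[d₃]
      ((machine c).step w (((machine c).step w)^[d₂] (((machine c).step w)^[d]
        (machine c).init))) := by
    unfold PrefixTM.run
    rw [Function.iterate_add_apply, Function.iterate_add_apply, Function.iterate_add_apply]
    rfl
  refine ⟨?_, ?_, ?_⟩
  · rw [e₃]; exact e₂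
  · rw [e₃, ht.pos]
    simp only [Bool.false_eq_true, if_false]
    omega
  · rw [e₃, ht.out]; simp

end StackMachine

/-! ### Runs of a prefix machine: monotonicity in time and prefix-freeness of the domain. -/

namespace PrefixTM

variable (T : PrefixTM)

/-- The input sequence that starts with `p` and continues with zeros. -/
abbrev pad (p : List Bool) : ℕ → Bool := fun k => p.getD k false

theorem run_succ (w : ℕ → Bool) (d : ℕ) : T.run w (d + 1) = T.step w (T.run w d) :=
  Function.iterate_succ_apply' _ _ _

variable {T}

theorem step_of_halted {w : ℕ → Bool} {c : T.Cfg} (h : T.action w c = none) :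
    T.step w c = c := by
  unfold step
  rw [h]

theorem run_of_halted {w : ℕ → Bool} {d e : ℕ} (h : T.action w (T.run w d) = none)
    (hde : d ≤ e) : T.run w e = T.run w d := by
  induction e, hde using Nat.le_induction with
  | base => rfl
  | succ e _ ih => rw [run_succ, ih, step_of_halted h]

theorem pos_le_step (w : ℕ → Bool) (c : T.Cfg) :
    c.pos ≤ (T.step w c).pos ∧ (T.step w c).pos ≤ c.pos + 1 := by
  unfold step
  split
  · simp
  · dsimp only
    split <;> omega

theorem length_out_step (w : ℕ → Bool) (c : T.Cfg) :
    (T.step w c).out.length ≤ c.out.length + 1 := by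
  unfold step
  split
  · simp
  · rename_i a _
    rcases a.emit with _ | b <;> simp

theorem pos_run_le (w : ℕ → Bool) (d : ℕ) : (T.run w d).pos ≤ d := by
  induction d with
  | zero => exact le_rfl
  | succ d ih =>
    rw [run_succ]
    exact (pos_le_step w _).2.trans (by omega)

theorem length_out_run_le (w : ℕ → Bool) (d : ℕ) : (T.run w d).out.length ≤ d := by
  induction d with
  | zero => exact le_rfl
  | succ d ih =>
    rw [run_succ]
    exact (length_out_step w _).trans (by omega)

theorem run_congr {w w' : ℕ → Bool} (d : ℕ) (h : ∀ k ≤ (T.run w d).pos, w k = w' k) :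
    T.run w d = T.run w' d := by
  induction d with
  | zero => rfl
  | succ d ih =>
    rw [run_succ] at h
    have hp := (pos_le_step w (T.run w d)).1
    have e := ih fun k hk => h k (hk.trans hp)
    have ha : T.action w (T.run w d) = T.action w' (T.run w d) := by
      unfold action
      rw [h _ hp]
    rw [run_succ, run_succ, ← e]
    unfold step
    rw [ha]

theorem HaltsWithin.mono {p y : List Bool} {d e : ℕ} (h : T.HaltsWithin p d y) (hde : d ≤ e) :
    T.HaltsWithin p e y := by
  unfold HaltsWithin at *
  rw [run_of_halted h.1 hde]
  exact h

theorem HaltsWithin.length_le {p y : List Bool} {d : ℕ} (h : T.HaltsWithin p d y) :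
    p.length ≤ d + 1 := by
  rw [← h.2.1]
  exact Nat.succ_le_succ (pos_run_le _ _)

theorem HaltsWithin.length_out_le {p y : List Bool} {d : ℕ} (h : T.HaltsWithin p d y) :
    y.length ≤ d := by
  rw [← h.2.2]
  exact length_out_run_le _ _

theorem HaltsWithin.ne_nil {p y : List Bool} {d : ℕ} (h : T.HaltsWithin p d y) : p ≠ [] := by
  rintro rfl
  exact absurd h.2.1 (by simp)

theorem Computes.ne_nil {p y : List Bool} (h : T.Computes p y) : p ≠ [] :=
  let ⟨_, h⟩ := h; h.ne_nil

/-- The run on `p` only sees squares of `p`, where `q` has the same bits, so both runs coincide. The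
final head position then determines the length of the program. -/
theorem Computes.prefix_unique {p q y z : List Bool} (hp : T.Computes p y) (hq : T.Computes q z)
    (h : p <+: q) : p = q ∧ y = z := by
  obtain ⟨d, hp⟩ := hp
  obtain ⟨e, hq⟩ := hq
  have hp := hp.mono (le_max_left d e)
  have hq := hq.mono (le_max_right d e)
  have e₁ : T.run (pad p) (max d e) = T.run (pad q) (max d e) := by
    refine run_congr _ fun k hk => ?_
    have hk' : k < p.length := by
      have h₁ : (T.run (pad p) (max d e)).pos + 1 = p.length := hp.2.1
      omega
    obtain ⟨r, rfl⟩ := h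
    simp [pad, List.getElem?_append_left hk']
  have hl : p.length = q.length := by
    rw [← hp.2.1, ← hq.2.1]
    exact congrArg (fun c => c.pos + 1) e₁
  refine ⟨h.eq_of_length hl, ?_⟩
  rw [← hp.2.2, ← hq.2.2]
  exact congrArg Cfg.out e₁

theorem Computes.unique {p y z : List Bool} (h : T.Computes p y) (h' : T.Computes p z) : y = z :=
  (h.prefix_unique h' List.prefix_rfl).2

variable (T)

open Classical in
/-- The output of `T` on the program `p` if `T` halts within `d` steps. -/
noncomputable def outputAt (p : List Bool) (d : ℕ) : Option (List Bool) :=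
  if T.action (pad p) (T.run (pad p) d) = none ∧ (T.run (pad p) d).pos + 1 = p.length then
    some (T.run (pad p) d).out else none

variable {T}

theorem outputAt_eq_some {p y : List Bool} {d : ℕ} :
    T.outputAt p d = some y ↔ T.HaltsWithin p d y := by
  change _ ↔ T.action (pad p) (T.run (pad p) d) = none ∧
    (T.run (pad p) d).pos + 1 = p.length ∧ (T.run (pad p) d).out = y
  unfold outputAt
  split
  · simp_all
  · simp only [reduceCtorEq, false_iff]
    tauto

/-! ### Runs are primitive recursive. -/

/-- A finite type is primitively recursively encodable. -/
@[reducible]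
noncomputable def primcodableOfFinite (α : Type) [Finite α] : Primcodable α :=
  Primcodable.ofEquiv _ (Finite.equivFin α)

/-- A work tape as a pair of lists. -/
def workTapeEquiv (Sym : Type) : WorkTape Sym ≃ List Sym × List Sym where
  toFun t := (t.before, t.after)
  invFun t := ⟨t.1, t.2⟩
  left_inv _ := rfl
  right_inv _ := rfl

variable (T)

/-- A configuration as a tuple. -/
def cfgEquiv : T.Cfg ≃ T.State × ℕ × (Fin T.tapes → WorkTape T.Sym) × List Bool where
  toFun c := (c.state, c.pos, c.work, c.out)
  invFun c := ⟨c.1, c.2.1, c.2.2.1, c.2.2.2⟩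
  left_inv _ := rfl
  right_inv _ := rfl

/-- States are encodable. -/
@[reducible]
noncomputable def primcodableState : Primcodable T.State :=
  haveI := T.finite_state
  primcodableOfFinite T.State

/-- Work tape symbols are encodable. -/
@[reducible]
noncomputable def primcodableSym : Primcodable T.Sym :=
  haveI := T.finite_sym
  primcodableOfFinite T.Sym

attribute [local instance] primcodableState primcodableSym

/-- Work tapes are encodable. -/
@[reducible]
noncomputable def primcodableWorkTape : Primcodable (WorkTape T.Sym) :=
  Primcodable.ofEquiv _ (workTapeEquiv T.Sym)

attribute [local instance] primcodableWorkTape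

/-- Configurations are encodable. -/
@[reducible]
noncomputable def primcodableCfg : Primcodable T.Cfg :=
  Primcodable.ofEquiv _ T.cfgEquiv

attribute [local instance] primcodableCfg

theorem primrec_before : Primrec (WorkTape.before : WorkTape T.Sym → _) :=
  Primrec.fst.comp (Primrec.of_equiv (e := workTapeEquiv T.Sym))

theorem primrec_after : Primrec (WorkTape.after : WorkTape T.Sym → _) :=
  Primrec.snd.comp (Primrec.of_equiv (e := workTapeEquiv T.Sym))

theorem primrec_mk : Primrec₂ (WorkTape.mk : List T.Sym → List T.Sym → WorkTape T.Sym) :=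
  (Primrec.of_equiv_symm (e := workTapeEquiv T.Sym))

theorem primrec_read (b : T.Sym) : Primrec (WorkTape.read b : WorkTape T.Sym → T.Sym) := by
  have : (WorkTape.read b : WorkTape T.Sym → T.Sym) = fun t => t.after.head?.getD b := by
    funext t
    simp [WorkTape.read, List.headD_eq_head?_getD]
  rw [this]
  exact Primrec.option_getD.comp (Primrec.list_head?.comp T.primrec_after) (Primrec.const b)

theorem primrec_act (a : T.Sym × HeadMove) : Primrec fun t : WorkTape T.Sym => t.act a := by
  have htl : Primrec fun t : WorkTape T.Sym => a.1 :: t.after.tail :=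
    Primrec.list_cons.comp (Primrec.const _) (Primrec.list_tail.comp T.primrec_after)
  rcases a with ⟨s, _ | _ | _⟩
  · have h : Primrec fun t : WorkTape T.Sym => WorkTape.mk t.before.tail
        (t.before.head?.toList ++ (s :: t.after.tail)) :=
      T.primrec_mk.comp (Primrec.list_tail.comp T.primrec_before)
        (Primrec.list_append.comp
          (Primrec.optionToList.comp (Primrec.list_head?.comp T.primrec_before)) htl)
    refine h.of_eq fun t => ?_
    rcases t with ⟨_ | _, _⟩ <;> rfl
  · exact (T.primrec_mk.comp T.primrec_before htl).of_eq fun _ => rfl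
  · exact (T.primrec_mk.comp (Primrec.list_cons.comp (Primrec.const _) T.primrec_before)
      (Primrec.list_tail.comp T.primrec_after)).of_eq fun _ => rfl

theorem primrec_cfg : Primrec T.cfgEquiv := Primrec.of_equiv

theorem primrec_state : Primrec (Cfg.state : T.Cfg → _) := Primrec.fst.comp T.primrec_cfg

theorem primrec_pos : Primrec (Cfg.pos : T.Cfg → _) :=
  Primrec.fst.comp (Primrec.snd.comp T.primrec_cfg)

theorem primrec_work : Primrec (Cfg.work : T.Cfg → _) :=
  Primrec.fst.comp (Primrec.snd.comp (Primrec.snd.comp T.primrec_cfg))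

theorem primrec_out : Primrec (Cfg.out : T.Cfg → _) :=
  Primrec.snd.comp (Primrec.snd.comp (Primrec.snd.comp T.primrec_cfg))

theorem primrec_work_apply (k : Fin T.tapes) : Primrec fun c : T.Cfg => c.work k :=
  Primrec.fin_app.comp T.primrec_work (Primrec.const k)

/-- The arguments of the transition function. -/
abbrev Scan : Type := T.State × Bool × (Fin T.tapes → T.Sym)

/-- What a machine sees in a configuration. -/
def scan (p : List Bool) (c : T.Cfg) : T.Scan :=
  (c.state, pad p c.pos, fun k => (c.work k).read T.blank)

theorem primrec_scan : Primrec₂ T.scan := by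
  refine Primrec.pair (T.primrec_state.comp Primrec.snd) (Primrec.pair ?_ ?_)
  · exact (Primrec.list_getD false).comp Primrec.fst (T.primrec_pos.comp Primrec.snd)
  · refine Primrec.fin_curry.2 (Primrec₂.swap (Primrec.fin_curry₁.2 fun k => ?_))
    exact (T.primrec_read _).comp ((T.primrec_work_apply k).comp Primrec.snd)

instance : Finite T.Scan := by
  have := T.finite_state
  have := T.finite_sym
  infer_instance

/-- The effect of an action. -/
def perform (c : T.Cfg) : Option (StepAction T.tapes T.State T.Sym) → T.Cfg
  | none => c
  | some a =>
    { state := a.next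
      pos := if a.advance then c.pos + 1 else c.pos
      work := fun k => (c.work k).act (a.work k)
      out := c.out ++ a.emit.toList }

theorem primrec_perform (o : Option (StepAction T.tapes T.State T.Sym)) :
    Primrec fun c : T.Cfg => T.perform c o := by
  rcases o with _ | a
  · exact Primrec.id
  · have h₁ : Primrec fun c : T.Cfg => if a.advance then c.pos + 1 else c.pos := by
      cases a.advance
      · exact T.primrec_pos
      · exact Primrec.succ.comp T.primrec_pos
    have h₂ : Primrec fun (c : T.Cfg) k => (c.work k).act (a.work k) :=
      Primrec.fin_curry.2 (Primrec₂.swap (Primrec.fin_curry₁.2 fun k =>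
        (T.primrec_act (a.work k)).comp (T.primrec_work_apply k)))
    have h₃ : Primrec fun c : T.Cfg => c.out ++ a.emit.toList :=
      Primrec.list_append.comp T.primrec_out (Primrec.const _)
    exact (Primrec.of_equiv_symm (e := T.cfgEquiv)).comp
      (Primrec.pair (Primrec.const a.next) (Primrec.pair h₁ (Primrec.pair h₂ h₃)))

/-- Only finitely many scans are possible, so a step is a finite case distinction with a primitive
recursive update in each case, whatever `delta` is. -/
theorem primrec_step : Primrec₂ fun p c => T.step (pad p) c := by
  let e := Finite.equivFin T.Scan
  have h : Primrec₂ fun (i : Fin (Nat.card T.Scan)) (c : T.Cfg) =>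
      T.perform c (T.delta (e.symm i).1 (e.symm i).2.1 (e.symm i).2.2) :=
    Primrec.fin_curry₁.2 fun i => T.primrec_perform _
  refine (h.comp ((Primrec.dom_finite e).comp T.primrec_scan) Primrec.snd).of_eq fun ⟨p, c⟩ => ?_
  simp only [Equiv.symm_apply_apply]
  unfold step action
  change T.perform c (T.delta c.state (pad p c.pos) fun k => (c.work k).read T.blank) = _
  split <;> rename_i h <;> rw [h] <;> rfl

theorem primrec_run : Primrec₂ fun p d => T.run (pad p) d :=
  Primrec.nat_iterate Primrec.snd (Primrec.const T.init)
    (T.primrec_step.comp (Primrec.fst.comp Primrec.fst) Primrec.snd)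

theorem primrec_outputAt : Primrec₂ T.outputAt := by
  classical
  have h₁ : PrimrecPred fun x : List Bool × ℕ =>
      T.action (pad x.1) (T.run (pad x.1) x.2) = none := by
    have : Primrec fun s : T.Scan => (T.delta s.1 s.2.1 s.2.2).isNone := Primrec.dom_finite _
    have := this.comp (T.primrec_scan.comp Primrec.fst T.primrec_run)
    refine ((Primrec.eq.comp this (Primrec.const true)) : PrimrecPred _).of_eq fun x => ?_
    simp [Option.isNone_iff_eq_none, action, scan]
  have h₂ : PrimrecPred fun x : List Bool × ℕ =>
      (T.run (pad x.1) x.2).pos + 1 = x.1.length :=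
    Primrec.eq.comp (Primrec.succ.comp (T.primrec_pos.comp T.primrec_run))
      (Primrec.list_length.comp Primrec.fst)
  refine (Primrec.ite (h₁.and h₂) (Primrec.option_some.comp (T.primrec_out.comp T.primrec_run))
    (Primrec.const none)).of_eq fun x => ?_
  simp only [outputAt]

end PrefixTM

/-! ### Prefix machines for partial recursive functions with prefix-free domain. -/

open Nat.Partrec (Code)

theorem Primrec.list_isPrefix {α : Type*} [Primcodable α] :
    PrimrecPred fun x : List α × List α => x.1 <+: x.2 := by
  classical
  have : PrimrecPred fun x : List α × List α => x.2.take x.1.length = x.1 :=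
    Primrec.eq.comp (Primrec.list_take.comp (Primrec.list_length.comp Primrec.fst) Primrec.snd)
      Primrec.fst
  refine this.of_eq fun x => ?_
  rw [List.prefix_iff_eq_take, eq_comm]

/-- A partial recursive function can be transported along a computable injection into `ℕ`. -/
theorem exists_nat_extension {α : Type*} [Primcodable α] {e : α → ℕ} (he : Computable e)
    (hinj : Function.Injective e) {F : α →. ℕ} (hF : Partrec F) :
    ∃ F' : ℕ →. ℕ, Nat.Partrec F' ∧ ∀ a, F' (e a) = F a := by
  -- The extension searches for a preimage of `n` under `e` and diverges if there is none.
  let g : ℕ → ℕ → Option α := fun n k =>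
    (Encodable.decode k : Option α).bind fun a => if e a = n then some a else none
  have hg : Computable₂ g := by
    have h₁ : Computable fun x : ℕ × ℕ => (Encodable.decode x.2 : Option α) :=
      Computable.decode.comp Computable.snd
    refine Computable.option_bind h₁ ?_
    have h₂ : Computable fun x : (ℕ × ℕ) × α => decide (e x.2 = x.1.1) :=
      (Primrec.eq (α := ℕ)).decide.to_comp.comp (he.comp Computable.snd)
        (Computable.fst.comp Computable.fst)
    refine (Computable.cond h₂ (Computable.option_some.comp Computable.snd)
      (Computable.const none)).of_eq fun x => ?_
    by_cases h : e x.2 = x.1.1 <;> simp [h]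
  refine ⟨fun n => (Nat.rfindOpt (g n)).bind F, Partrec.nat_iff.1
    ((Partrec.rfindOpt hg).bind (hF.comp Computable.snd).to₂), fun a => ?_⟩
  have hmem : ∀ b k, b ∈ g (e a) k → b = a := by
    intro b k h
    simp only [g, Option.mem_def, Option.bind_eq_some_iff] at h
    obtain ⟨c, _, h⟩ := h
    split at h
    · rename_i h'
      cases h
      exact hinj h'
    · cases h
  have : Nat.rfindOpt (g (e a)) = Part.some a := by
    have hd : (Nat.rfindOpt (g (e a))).Dom := Nat.rfindOpt_dom.2 ⟨Encodable.encode a, a, by simp [g]⟩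
    obtain ⟨b, hb⟩ := Part.dom_iff_mem.1 hd
    obtain ⟨k, hk⟩ := Nat.rfindOpt_spec hb
    rw [hmem b k hk] at hb
    exact Part.eq_some_iff.2 hb
  change (Nat.rfindOpt (g (e a))).bind F = F a
  rw [this]
  exact Part.bind_some a F

namespace StackMachine

theorem primrec_digits : Primrec digits := by
  have h : Primrec fun y : List Bool => y.foldr (fun b n => 2 * n + cond b 1 0) 1 :=
    Primrec.list_foldr Primrec.id (Primrec.const 1) (Primrec.nat_add.comp
      (Primrec.nat_mul.comp (Primrec.const 2) (Primrec.snd.comp Primrec.snd))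
      (Primrec.cond (Primrec.fst.comp Primrec.snd) (Primrec.const 1) (Primrec.const 0))).to₂
  refine h.of_eq fun y => ?_
  induction y with
  | nil => rfl
  | cons b y ih => cases b <;> simp [digits, ← ih]

theorem digits_injective : Function.Injective digits := by
  intro x
  induction x with
  | nil =>
    rintro (_ | ⟨b, y⟩) h
    · rfl
    · have := digits_pos y
      cases b <;> simp [digits] at h <;> omega
  | cons a x ih =>
    rintro (_ | ⟨b, y⟩) h
    · have := digits_pos x
      cases a <;> simp [digits] at h <;> omega
    · have h₁ : a = b ∧ digits x = digits y := by
        cases a <;> cases b <;> simp [digits] at h ⊢ <;> omega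
      rw [h₁.1, ih h₁.2]

/-- A partial recursive function that on a proper initial segment of the program `p` asks for more
input, and on `p` gives the output, is computed by a prefix machine. -/
theorem exists_machine {F : List Bool →. Option (List Bool)} (hF : Partrec F) :
    ∃ T : PrefixTM, ∀ p y : List Bool, p ≠ [] →
      (∀ s : List Bool, s ≠ [] → s <+: p → s ≠ p → none ∈ F s) → some y ∈ F p →
        T.Computes p y := by
  -- The lowest digit is the flag that the machine inspects. In a request for input the bits read so
  -- far lie below it, so popping the flag restores the argument.
  let G : List Bool →. ℕ := fun s =>
    (F s).map fun o => digits (o.elim (true :: s.reverse) fun y => false :: y)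
  have hG : Partrec G := by
    refine hF.map (Primrec.to_comp ?_)
    refine primrec_digits.comp ?_
    refine (Primrec.option_casesOn Primrec.snd
      (Primrec.list_cons.comp (Primrec.const true) (Primrec.list_reverse.comp Primrec.fst))
      (Primrec.list_cons.comp (Primrec.const false) Primrec.snd).to₂).of_eq fun x => ?_
    rcases x.2 with _ | _ <;> rfl
  obtain ⟨G', hG', hGG'⟩ := exists_nat_extension
    (primrec_digits.comp Primrec.list_reverse).to_comp
    (digits_injective.comp List.reverse_injective) hG
  obtain ⟨c, hc⟩ := Turing.ToPartrec.Code.exists_code (Nat.Partrec'.part_iff₁.2 (Partrec.nat_iff.2 hG'))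
  have key : ∀ s m, m ∈ G s → [m] ∈ c.eval [digits s.reverse] := by
    intro s m hm
    have := hc ⟨[digits s.reverse], rfl⟩
    change c.eval [digits s.reverse] = _ at this
    rw [this]
    have e : G' (digits s.reverse) = G s := hGG' s
    refine Part.mem_map_iff _ |>.2 ⟨m, ?_, rfl⟩
    change m ∈ G' (digits s.reverse)
    rwa [e]
  refine ⟨machine c, fun p y hp h₁ h₂ => machine_computes hp (fun s hs hsp hne => ?_) ?_⟩
  · exact key s _ (Part.mem_map_iff _ |>.2 ⟨none, h₁ s hs hsp hne, rfl⟩)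
  · exact key p _ (Part.mem_map_iff _ |>.2 ⟨some y, h₂, rfl⟩)

end StackMachine

/-- A partial function on strings whose domain is prefix-free and does not contain the empty
string. -/
structure PrefixFree (f : List Bool →. List Bool) : Prop where
  nil : ∀ y, y ∉ f []
  eq : ∀ {p q y z}, y ∈ f p → z ∈ f q → p <+: q → p = q

/-- On input `s`, dovetail the computations of `f` until some `q` in the domain extends `s`; give
the output if `q = s`, otherwise ask for a bit. Prefix-freeness makes the decision independent of
the `q` found: if `s` is in the domain it is the only candidate, and a proper initial segment of a
domain element is never in the domain. -/
theorem PrefixFree.exists_machine {f : List Bool →. List Bool} (hf : Partrec f)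
    (hpf : PrefixFree f) :
    ∃ T : PrefixTM, ∀ p y, y ∈ f p → T.Computes p y := by
  classical
  obtain ⟨cf, hcf⟩ := Code.exists_code.1 hf
  let g : List Bool → ℕ → Option (Option (List Bool)) := fun s k =>
    (Encodable.decode k.unpair.2 : Option (List Bool)).bind fun q =>
      (Code.evaln k.unpair.1 cf k.unpair.2).bind fun m =>
        if s <+: q then some (if q = s then (Encodable.decode m : Option (List Bool)) else none)
        else none
  have hg : Primrec₂ g := by
    have h₁ : Primrec fun x : List Bool × ℕ =>
        (Encodable.decode x.2.unpair.2 : Option (List Bool)) :=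
      Primrec.decode.comp (Primrec.snd.comp (Primrec.unpair.comp Primrec.snd))
    refine Primrec.option_bind h₁ ?_
    have hu : Primrec fun x : (List Bool × ℕ) × List Bool => x.1.2.unpair :=
      Primrec.unpair.comp (Primrec.snd.comp Primrec.fst)
    have h₂ : Primrec fun x : (List Bool × ℕ) × List Bool =>
        Code.evaln x.1.2.unpair.1 cf x.1.2.unpair.2 :=
      Code.primrec_evaln.comp (Primrec.pair (Primrec.pair (Primrec.fst.comp hu) (Primrec.const cf))
        (Primrec.snd.comp hu))
    refine Primrec.option_bind h₂ ?_
    have hs : Primrec fun x : ((List Bool × ℕ) × List Bool) × ℕ => x.1.1.1 :=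
      Primrec.fst.comp (Primrec.fst.comp Primrec.fst)
    have hq : Primrec fun x : ((List Bool × ℕ) × List Bool) × ℕ => x.1.2 :=
      Primrec.snd.comp Primrec.fst
    exact Primrec.ite (Primrec.list_isPrefix.comp (Primrec.pair hs hq))
      (Primrec.option_some.comp (Primrec.ite (Primrec.eq.comp hq hs)
        (Primrec.decode.comp Primrec.snd) (Primrec.const none))) (Primrec.const none)
  have mem_g : ∀ {s k o}, o ∈ g s k → ∃ q y, y ∈ f q ∧ s <+: q ∧ o = if q = s then some y else none := by
    intro s k o h
    simp only [g, Option.mem_def, Option.bind_eq_some_iff] at h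
    obtain ⟨q, hq, m, hm, h⟩ := h
    split at h
    · rename_i hsq
      have hm' := Code.evaln_sound hm
      rw [hcf] at hm'
      simp only [hq, Part.coe_some, Part.bind_some, Part.mem_map_iff] at hm'
      obtain ⟨y, hy, rfl⟩ := hm'
      refine ⟨q, y, hy, hsq, ?_⟩
      cases h
      simp
    · cases h
  have g_dom : ∀ {s p y}, y ∈ f p → s <+: p → ∃ k o, o ∈ g s k := by
    intro s p y hy hsp
    have : Encodable.encode y ∈ cf.eval (Encodable.encode p) := by
      rw [hcf]
      simp only [Encodable.encodek, Part.coe_some, Part.bind_some, Part.mem_map_iff]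
      exact ⟨y, hy, rfl⟩
    obtain ⟨t, ht⟩ := Code.evaln_complete.1 this
    refine ⟨Nat.pair t (Encodable.encode p), if p = s then some y else none, ?_⟩
    rw [Option.mem_def] at ht
    simp [g, ht, hsp]
  obtain ⟨T, hT⟩ := StackMachine.exists_machine (Partrec.rfindOpt hg.to_comp)
  refine ⟨T, fun p y hy => hT p y ?_ (fun s _ hsp hne => ?_) ?_⟩
  · rintro rfl; exact hpf.nil _ hy
  · obtain ⟨k, hk⟩ := g_dom hy hsp
    obtain ⟨o, ho⟩ := Part.dom_iff_mem.1 (Nat.rfindOpt_dom.2 ⟨k, hk⟩)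
    obtain ⟨k', hk'⟩ := Nat.rfindOpt_spec ho
    obtain ⟨q, z, hz, hsq, rfl⟩ := mem_g hk'
    split at ho
    · rename_i h
      subst h
      exact absurd (hpf.eq hz hy hsp) hne
    · exact ho
  · obtain ⟨k, hk⟩ := g_dom hy List.prefix_rfl
    obtain ⟨o, ho⟩ := Part.dom_iff_mem.1 (Nat.rfindOpt_dom.2 ⟨k, hk⟩)
    obtain ⟨k', hk'⟩ := Nat.rfindOpt_spec ho
    obtain ⟨q, z, hz, hsq, rfl⟩ := mem_g hk'
    obtain rfl := hpf.eq hy hz hsq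
    rw [if_pos rfl, Part.mem_unique hz hy] at ho
    exact ho

/-! ### Programs for the optimal machine and upper bounds on complexity. -/

namespace PrefixTM

variable (U : PrefixTM)

/-- The partial function computed by `U`. -/
noncomputable def eval (p : List Bool) : Part (List Bool) := Nat.rfindOpt (U.outputAt p)

variable {U}

theorem mem_eval {p y : List Bool} : y ∈ U.eval p ↔ U.Computes p y := by
  unfold eval
  rw [Nat.rfindOpt_mono]
  · simp only [Option.mem_def, outputAt_eq_some]
    rfl
  · intro y d e hde h
    rw [Option.mem_def, outputAt_eq_some] at *
    exact h.mono hde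

theorem partrec_eval : Partrec U.eval := Partrec.rfindOpt U.primrec_outputAt.to_comp

theorem IsOptimal.exists_prefix (hU : U.IsOptimal) {f : List Bool →. List Bool} (hf : Partrec f)
    (hpf : PrefixFree f) : ∃ i : List Bool, ∀ p y, y ∈ f p → U.Computes (i ++ p) y := by
  obtain ⟨T, hT⟩ := hpf.exists_machine hf
  obtain ⟨i, hi⟩ := hU T
  exact ⟨i, fun p y hy => (hi p y).2 (hT p y hy)⟩

/-- `U` can run a program `a`, and then process further input `r` depending on `a`. -/
theorem IsOptimal.exists_prefix_append (hU : U.IsOptimal) {g : List Bool → List Bool →. List Bool}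
    (hg : Partrec₂ g)
    (hpf : ∀ a x, U.Computes a x → ∀ r s y z, y ∈ g a r → z ∈ g a s → r <+: s → r = s) :
    ∃ i : List Bool, ∀ a x r y, U.Computes a x → y ∈ g a r → U.Computes (i ++ (a ++ r)) y := by
  -- The number `k` codes a guess of the length of the initial program and of a time in which it
  -- halts. The length is unique, as the domain of `U` is prefix-free.
  let h : List Bool → ℕ → Option ℕ := fun q k =>
    (U.outputAt (q.take k.unpair.1) k.unpair.2).map fun _ => k.unpair.1
  have hh : Computable₂ h := by
    have hu : Primrec fun x : List Bool × ℕ => x.2.unpair := Primrec.unpair.comp Primrec.snd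
    have : Primrec₂ h := Primrec.option_map
      (U.primrec_outputAt.comp (Primrec.list_take.comp (Primrec.fst.comp hu) Primrec.fst)
        (Primrec.snd.comp hu))
      ((Primrec.fst.comp hu).comp Primrec.fst).to₂
    exact this.to_comp
  let f : List Bool →. List Bool := fun q =>
    (Nat.rfindOpt (h q)).bind fun n => g (q.take n) (q.drop n)
  have hf : Partrec f := by
    refine (Partrec.rfindOpt hh).bind ?_
    exact hg.comp (Primrec.list_take.comp Primrec.snd Primrec.fst).to_comp
      (Primrec.list_drop.comp Primrec.snd Primrec.fst).to_comp
  have mem_h : ∀ {q k n}, n ∈ h q k → ∃ x, U.Computes (q.take n) x := by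
    intro q k n hn
    simp only [h, Option.mem_def, Option.map_eq_some_iff] at hn
    obtain ⟨x, hx, rfl⟩ := hn
    exact ⟨x, _, outputAt_eq_some.1 hx⟩
  have mem_f : ∀ {q y}, y ∈ f q → ∃ a r x, q = a ++ r ∧ U.Computes a x ∧ y ∈ g a r := by
    intro q y hy
    obtain ⟨n, hn, hy⟩ := Part.mem_bind_iff.1 hy
    obtain ⟨k, hk⟩ := Nat.rfindOpt_spec hn
    obtain ⟨x, hx⟩ := mem_h hk
    exact ⟨_, _, x, (List.take_append_drop n q).symm, hx, hy⟩
  have hfpf : PrefixFree f := by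
    refine ⟨fun y hy => ?_, fun {p q y z} hy hz hpq => ?_⟩
    · obtain ⟨a, r, x, hq, hx, _⟩ := mem_f hy
      exact hx.ne_nil (List.append_eq_nil_iff.1 hq.symm).1
    · obtain ⟨a, r, x, rfl, hx, hy⟩ := mem_f hy
      obtain ⟨b, s, w, rfl, hw, hz⟩ := mem_f hz
      have hab : a = b := by
        rcases List.prefix_or_prefix_of_prefix ((List.prefix_append a r).trans hpq)
          (List.prefix_append b s) with h | h
        · exact (hx.prefix_unique hw h).1
        · exact (hw.prefix_unique hx h).1.symm
      subst hab
      rw [hpf a x hx r s y z hy hz ((List.prefix_append_right_inj a).1 hpq)]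
  obtain ⟨i, hi⟩ := hU.exists_prefix hf hfpf
  refine ⟨i, fun a x r y hx hy => hi _ _ ?_⟩
  obtain ⟨d, hd⟩ := id hx
  have hdom : ∃ k n, n ∈ h (a ++ r) k := by
    refine ⟨Nat.pair a.length d, a.length, ?_⟩
    simp [h, outputAt_eq_some.2 hd]
  obtain ⟨n, hn⟩ := Part.dom_iff_mem.1 (Nat.rfindOpt_dom.2 hdom)
  obtain ⟨k, hk⟩ := Nat.rfindOpt_spec hn
  obtain ⟨z, hz⟩ := mem_h hk
  have ha : (a ++ r).take n = a := by
    rcases List.prefix_or_prefix_of_prefix (List.take_prefix n (a ++ r)) (List.prefix_append a r)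
      with h | h
    · exact (hz.prefix_unique hx h).1
    · exact (hx.prefix_unique hz h).1.symm
  have hr : (a ++ r).drop n = r := by
    have := List.take_append_drop n (a ++ r)
    rw [ha] at this
    exact List.append_cancel_left this
  refine Part.mem_bind_iff.2 ⟨n, hn, ?_⟩
  rw [ha, hr]
  exact hy

theorem complexity_le {p y : List Bool} (h : U.Computes p y) : U.complexity y ≤ p.length :=
  Nat.sInf_le ⟨p, rfl, h⟩

/-- `n` ones and a zero. -/
def unary (n : ℕ) : List Bool := List.replicate n true ++ [false]

@[simp] theorem length_unary (n : ℕ) : (unary n).length = n + 1 := by simp [unary]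

theorem primrec_unary : Primrec unary := by
  have : Primrec fun n : ℕ => (List.range n).map (fun _ => true) ++ [false] :=
    Primrec.list_append.comp (Primrec.list_map Primrec.list_range (Primrec.const true).to₂)
      (Primrec.const _)
  refine this.of_eq fun n => ?_
  simp [unary, List.map_const']

theorem unary_prefix {m n : ℕ} (h : unary m <+: unary n) : m = n := by
  induction m generalizing n with
  | zero =>
    rcases n with _ | n
    · rfl
    · simp [unary, List.replicate_succ] at h
  | succ m ih =>
    rcases n with _ | n
    · simp [unary, List.replicate_succ] at h
    · rw [ih (n := n)]
      simpa [unary, List.replicate_succ] using h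

/-- Unary numerals are prefix-free. Their programs are the seed from which `exists_literal` obtains
programs for all strings. -/
theorem IsOptimal.exists_unary (hU : U.IsOptimal) :
    ∃ i : List Bool, ∀ n, U.Computes (i ++ unary n) (unary n) := by
  let f : List Bool →. List Bool := fun p =>
    ((if p = unary (p.length - 1) then some p else none : Option (List Bool)) : Part (List Bool))
  have hf : Partrec f := by
    refine Computable.ofOption (Primrec.to_comp ?_)
    exact Primrec.ite (Primrec.eq.comp Primrec.id (primrec_unary.comp
      (Primrec.nat_sub.comp Primrec.list_length (Primrec.const 1))))
      Primrec.option_some (Primrec.const none)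
  have hf' : ∀ {p y}, y ∈ f p → ∃ n, p = unary n := by
    intro p y h
    simp only [f, Part.mem_coe, Option.mem_def] at h
    split at h
    · exact ⟨_, ‹_›⟩
    · cases h
  obtain ⟨i, hi⟩ := hU.exists_prefix hf ⟨fun y hy => by
      obtain ⟨n, hn⟩ := hf' hy
      simpa using congrArg List.length hn,
    fun {p q y z} hy hz h => by
      obtain ⟨n, rfl⟩ := hf' hy
      obtain ⟨m, rfl⟩ := hf' hz
      rw [unary_prefix h]⟩
  exact ⟨i, fun n => hi _ _ (by simp [f])⟩

/-- Given a length computed from a program `a`, a string of this length can be appended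
literally. -/
theorem IsOptimal.exists_literal (hU : U.IsOptimal) {L : List Bool →. ℕ} (hL : Partrec L) :
    ∃ i : List Bool, ∀ a x y, U.Computes a x → y.length ∈ L a → U.Computes (i ++ (a ++ y)) y := by
  let g : List Bool → List Bool →. List Bool := fun a r =>
    (L a).bind fun n => ((if r.length = n then some r else none : Option (List Bool)) :
      Part (List Bool))
  have hg : Partrec₂ g := by
    refine (hL.comp Computable.fst).bind (Computable.ofOption (Primrec.to_comp ?_))
    exact Primrec.ite (Primrec.eq.comp
      (Primrec.list_length.comp (Primrec.snd.comp Primrec.fst)) Primrec.snd)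
      (Primrec.option_some.comp (Primrec.snd.comp Primrec.fst)) (Primrec.const none)
  have hg' : ∀ {a r y}, y ∈ g a r → r.length ∈ L a := by
    intro a r y h
    obtain ⟨n, hn, h⟩ := Part.mem_bind_iff.1 h
    simp only [Part.mem_coe, Option.mem_def] at h
    split at h
    · rename_i e; rwa [e]
    · cases h
  obtain ⟨i, hi⟩ := hU.exists_prefix_append hg fun a x _ r s y z hr hs h =>
    h.eq_of_length (Part.mem_unique (hg' hr) (hg' hs))
  exact ⟨i, fun a x y hx hy => hi a x y y hx (Part.mem_bind_iff.2 ⟨_, hy, by simp⟩)⟩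

theorem IsOptimal.exists_computes (hU : U.IsOptimal) (x : List Bool) : ∃ p, U.Computes p x := by
  obtain ⟨i, hi⟩ := hU.exists_unary
  obtain ⟨j, hj⟩ := hU.exists_literal
    (L := fun a => (U.eval a).map fun y => y.length - 1)
    (partrec_eval.map (Primrec.nat_sub.comp (Primrec.list_length.comp Primrec.snd)
      (Primrec.const 1)).to_comp.to₂)
  exact ⟨_, hj _ _ x (hi x.length) (Part.mem_map_iff _ |>.2 ⟨_, mem_eval.2 (hi x.length), by simp⟩)⟩

theorem IsOptimal.exists_shortest (hU : U.IsOptimal) (x : List Bool) :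
    ∃ p : List Bool, p.length = U.complexity x ∧ U.Computes p x := by
  obtain ⟨p, hp⟩ := hU.exists_computes x
  exact Nat.sInf_mem (s := {n | ∃ p : List Bool, p.length = n ∧ U.Computes p x}) ⟨_, p, rfl, hp⟩

/-- Complexity does not increase, up to a constant, under partial recursive functions of the
program. -/
theorem IsOptimal.complexity_le_length (hU : U.IsOptimal) {F : List Bool →. List Bool}
    (hF : Partrec F) :
    ∃ c, ∀ a x y, U.Computes a x → y ∈ F a → U.complexity y ≤ a.length + c := by
  obtain ⟨i, hi⟩ := hU.exists_prefix_append
    (g := fun a r => ((if r = [] then some () else none : Option Unit) : Part Unit).bind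
      fun _ => F a)
    (Partrec.bind (Computable.ofOption (Primrec.to_comp (Primrec.ite
        (Primrec.eq.comp Primrec.snd (Primrec.const [])) (Primrec.const (some ()))
        (Primrec.const none))))
      (hF.comp (Computable.fst.comp Computable.fst)))
    (fun a x _ r s y z hr hs _ => by
      obtain ⟨_, hr, _⟩ := Part.mem_bind_iff.1 hr
      obtain ⟨_, hs, _⟩ := Part.mem_bind_iff.1 hs
      simp only [Part.mem_coe, Option.mem_def, Option.ite_none_right_eq_some] at hr hs
      rw [hr.1, hs.1])
  refine ⟨i.length, fun a x y hx hy => ?_⟩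
  have := complexity_le (hi a x [] y hx (Part.mem_bind_iff.2 ⟨(), by simp, hy⟩))
  simpa [add_comm] using this

/-- Complexity does not increase, up to a constant, under partial recursive functions. -/
theorem IsOptimal.complexity_map_le (hU : U.IsOptimal) {F : List Bool →. List Bool}
    (hF : Partrec F) : ∃ c, ∀ x y, y ∈ F x → U.complexity y ≤ U.complexity x + c := by
  obtain ⟨c, hc⟩ := hU.complexity_le_length (F := fun a => (U.eval a).bind F)
    (partrec_eval.bind (hF.comp Computable.snd))
  refine ⟨c, fun x y hy => ?_⟩
  obtain ⟨p, hp, hx⟩ := hU.exists_shortest x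
  rw [← hp]
  exact hc p x y hx (Part.mem_bind_iff.2 ⟨x, mem_eval.2 hx, hy⟩)

/-- The complexity of a string is at most that of its programs, up to a constant. -/
theorem IsOptimal.complexity_output_le (hU : U.IsOptimal) :
    ∃ c, ∀ p x, U.Computes p x → U.complexity x ≤ U.complexity p + c := by
  obtain ⟨c, hc⟩ := hU.complexity_map_le partrec_eval
  exact ⟨c, fun p x h => hc p x (mem_eval.2 h)⟩

theorem IsOptimal.complexity_le_add_unary (hU : U.IsOptimal) :
    ∃ c, ∀ x, U.complexity x ≤ x.length + U.complexity (unary x.length) + c := by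
  obtain ⟨i, hi⟩ := hU.exists_literal
    (L := fun a => (U.eval a).map fun y => y.length - 1)
    (partrec_eval.map (Primrec.nat_sub.comp (Primrec.list_length.comp Primrec.snd)
      (Primrec.const 1)).to_comp.to₂)
  refine ⟨i.length, fun x => ?_⟩
  obtain ⟨p, hp, hx⟩ := hU.exists_shortest (unary x.length)
  have := complexity_le (hi p _ x hx (Part.mem_map_iff _ |>.2 ⟨_, mem_eval.2 hx, by simp⟩))
  simp only [List.length_append] at this
  omega

open StackMachine in
/-- The complexity of `n` in unary notation is at most `2 log n + O(1)`. -/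
theorem IsOptimal.complexity_unary_le (hU : U.IsOptimal) :
    ∃ c, ∀ n, U.complexity (unary n) ≤ 2 * Nat.log 2 (n + 1) + c := by
  obtain ⟨i, hi⟩ := hU.exists_unary
  obtain ⟨c₁, hc₁⟩ := hU.complexity_le_add_unary
  have hF : Primrec fun y : List Bool => unary (digits y - 1) :=
    primrec_unary.comp (Primrec.nat_sub.comp primrec_digits (Primrec.const 1))
  obtain ⟨c₂, hc₂⟩ := hU.complexity_map_le (F := fun y => Part.some (unary (digits y - 1)))
    hF.to_comp.partrec
  have surj : ∀ n, 0 < n → ∃ y : List Bool, digits y = n ∧ y.length = Nat.log 2 n := by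
    intro n
    induction n using Nat.strong_induction_on with
    | _ n ih =>
      intro hn
      rcases Nat.lt_or_ge n 2 with h | h
      · obtain rfl : n = 1 := by omega
        exact ⟨[], rfl, by simp⟩
      · obtain ⟨y, hy, hl⟩ := ih (n / 2) (by omega) (by omega)
        refine ⟨n.bodd :: y, ?_, ?_⟩
        · rw [digits, hy, ← Nat.div2_val, Nat.bit_bodd_div2]
        · rw [List.length_cons, hl, Nat.log_div_base]
          have : 0 < Nat.log 2 n := Nat.log_pos (by norm_num) h
          omega
  refine ⟨i.length + 1 + c₁ + c₂, fun n => ?_⟩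
  obtain ⟨y, hy, hl⟩ := surj (n + 1) (by omega)
  -- The binary digits `y` of `n + 1` cost `|y|` bits literally and another `|y| + O(1)` for their
  -- length in unary; hence the factor 2.
  have h₁ := hc₂ y (unary n) (by simp [hy])
  have h₂ := hc₁ y
  have h₃ := complexity_le (hi y.length)
  simp only [List.length_append, length_unary] at h₃
  omega

end PrefixTM

/-! ### Enumeration of the halting programs and their weights. -/

namespace PrefixTM

variable (U : PrefixTM)

/-- Enumeration of the halting programs with their outputs: the pair of `p` and `d` yields `p` and
its output if `d` is the running time of `p`. -/
noncomputable def item (i : ℕ) : Option (List Bool × List Bool) :=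
  -- `decode₂` accepts only actual codes, so every halting program gets exactly one number.
  (Encodable.decode₂ (List Bool) i.unpair.1).bind fun p =>
    (U.outputAt p i.unpair.2).bind fun y =>
      if i.unpair.2 = 0 ∨ U.outputAt p (i.unpair.2 - 1) = none then some (p, y) else none

variable {U}

theorem item_eq_some {i : ℕ} {p y : List Bool} : U.item i = some (p, y) ↔
    ∃ d, i = Nat.pair (Encodable.encode p) d ∧ U.HaltsWithin p d y ∧
      ∀ e < d, ∀ z, ¬ U.HaltsWithin p e z := by
  unfold item
  simp only [Option.bind_eq_some_iff, outputAt_eq_some, Option.ite_none_right_eq_some,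
    Option.some.injEq, Prod.mk.injEq]
  constructor
  · rintro ⟨p, hp, y, hy, h, rfl, rfl⟩
    refine ⟨i.unpair.2, ?_, hy, fun e he z hz => ?_⟩
    · rw [Encodable.decode₂_eq_some.1 hp, Nat.pair_unpair]
    · rcases h with h | h
      · omega
      · have := hz.mono (show e ≤ i.unpair.2 - 1 by omega)
        rw [← outputAt_eq_some, h] at this
        cases this
  · rintro ⟨d, rfl, hy, h⟩
    refine ⟨p, by simp, y, by simpa using hy, ?_, rfl, rfl⟩
    simp only [Nat.unpair_pair]
    rcases Nat.eq_zero_or_pos d with rfl | hd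
    · exact Or.inl rfl
    · right
      rw [Option.eq_none_iff_forall_ne_some]
      intro z hz
      exact h (d - 1) (by omega) z (outputAt_eq_some.1 hz)

theorem item_unique {i j : ℕ} {p y z : List Bool} (hi : U.item i = some (p, y))
    (hj : U.item j = some (p, z)) : i = j := by
  obtain ⟨d, rfl, hd, hd'⟩ := item_eq_some.1 hi
  obtain ⟨e, rfl, he, he'⟩ := item_eq_some.1 hj
  rcases lt_trichotomy d e with h | rfl | h
  · exact absurd hd (he' d h y)
  · rfl
  · exact absurd he (hd' e h z)

theorem haltsWithin_of_item {i : ℕ} {p y : List Bool} (h : U.item i = some (p, y)) :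
    U.HaltsWithin p i.unpair.2 y := by
  obtain ⟨d, rfl, hd, _⟩ := item_eq_some.1 h
  simpa using hd

theorem computes_of_item {i : ℕ} {p y : List Bool} (h : U.item i = some (p, y)) :
    U.Computes p y :=
  ⟨_, haltsWithin_of_item h⟩

/-- The number of a program bounds its running time, which bounds the length of its output.
`exists_light` depends on this. -/
theorem length_le_of_item {i : ℕ} {p y : List Bool} (h : U.item i = some (p, y)) :
    y.length ≤ i :=
  (haltsWithin_of_item h).length_out_le.trans (Nat.unpair_right_le i)

theorem HaltsWithin.exists_item {p y : List Bool} {d : ℕ} (h : U.HaltsWithin p d y) :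
    ∃ e ≤ d, U.item (Nat.pair (Encodable.encode p) e) = some (p, y) := by
  classical
  have hex : ∃ e, U.HaltsWithin p e y := ⟨d, h⟩
  refine ⟨Nat.find hex, Nat.find_min' hex h, item_eq_some.2 ⟨_, rfl, Nat.find_spec hex, ?_⟩⟩
  intro e he z hz
  obtain rfl := Computes.unique ⟨e, hz⟩ ⟨d, h⟩
  exact Nat.find_min hex he hz

variable (U)

theorem primrec_item : Primrec U.item := by
  classical
  have hu : Primrec fun x : ℕ × List Bool => x.1.unpair := Primrec.unpair.comp Primrec.fst
  have hu' : Primrec fun x : (ℕ × List Bool) × List Bool => x.1.1.unpair := hu.comp Primrec.fst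
  have hd := Primrec.snd.comp hu'
  refine Primrec.option_bind (Primrec.decode₂.comp (Primrec.fst.comp Primrec.unpair)) ?_
  refine Primrec.option_bind (U.primrec_outputAt.comp Primrec.snd (Primrec.snd.comp hu)) ?_
  refine (Primrec.ite (PrimrecPred.or (Primrec.eq.comp hd (Primrec.const 0))
    (Primrec.eq.comp (U.primrec_outputAt.comp (Primrec.snd.comp Primrec.fst)
      (Primrec.nat_sub.comp hd (Primrec.const 1))) (Primrec.const none)))
    (Primrec.option_some.comp (Primrec.pair (Primrec.snd.comp Primrec.fst) Primrec.snd))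
    (Primrec.const none)).of_eq fun x => ?_
  rfl

/-- The weight `2 ^ -|p|` of the halting program `p` with number `i`, and `0` for other numbers. -/
noncomputable def weight (i : ℕ) : ℝ := (U.item i).elim 0 fun x => (1 / 2) ^ x.1.length

theorem weight_nonneg (i : ℕ) : 0 ≤ U.weight i := by
  unfold weight
  rcases U.item i with _ | x
  · exact le_rfl
  · simp only [Option.elim]; positivity

variable {U}

theorem weight_eq {i : ℕ} {p y : List Bool} (h : U.item i = some (p, y)) :
    U.weight i = (1 / 2) ^ p.length := by
  simp [weight, h]

/-- A prefix-free set of nonempty strings is uniquely decodable. -/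
theorem uniquelyDecodable_of_prefixFree {S : Set (List Bool)} (h₀ : [] ∉ S)
    (h : ∀ p ∈ S, ∀ q ∈ S, p <+: q → p = q) : InformationTheory.UniquelyDecodable S := by
  intro L₁
  induction L₁ with
  | nil =>
    rintro (_ | ⟨q, L₂⟩) _ h₂ e
    · rfl
    · simp only [List.flatten_nil, List.flatten_cons, List.nil_eq, List.append_eq_nil_iff] at e
      exact absurd (e.1 ▸ h₂ q (by simp)) h₀
  | cons p L₁ ih =>
    rintro (_ | ⟨q, L₂⟩) h₁ h₂ e
    · simp only [List.flatten_nil, List.flatten_cons, List.append_eq_nil_iff] at e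
      exact absurd (e.1 ▸ h₁ p (by simp)) h₀
    · simp only [List.flatten_cons] at e
      have hp := h₁ p (by simp)
      have hq := h₂ q (by simp)
      have hpq : p = q := by
        rcases List.prefix_or_prefix_of_prefix (List.prefix_append p L₁.flatten)
          (e ▸ List.prefix_append q L₂.flatten) with h' | h'
        · exact h p hp q hq h'
        · exact (h q hq p hp h').symm
      subst hpq
      rw [ih L₂ (fun w hw => h₁ w (by simp [hw])) (fun w hw => h₂ w (by simp [hw]))
        (List.append_cancel_left e)]

/-- Kraft's inequality: different numbers belong to different programs, and the halting programs are
prefix-free. -/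
theorem sum_weight_le (s : Finset ℕ) : ∑ i ∈ s, U.weight i ≤ 1 := by
  classical
  let S : Finset (List Bool) := s.biUnion fun i => ((U.item i).map Prod.fst).toFinset
  have hS : ∀ p ∈ S, ∃ i ∈ s, ∃ y, U.item i = some (p, y) := by
    intro p hp
    simp only [S, Finset.mem_biUnion, Option.mem_toFinset, Option.mem_def,
      Option.map_eq_some_iff] at hp
    obtain ⟨i, hi, ⟨q, y⟩, h, rfl⟩ := hp
    exact ⟨i, hi, y, h⟩
  have hU : InformationTheory.UniquelyDecodable (S : Set (List Bool)) := by
    refine uniquelyDecodable_of_prefixFree (fun h => ?_) fun p hp q hq h => ?_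
    · obtain ⟨i, _, y, h⟩ := hS _ h
      exact (computes_of_item h).ne_nil rfl
    · obtain ⟨i, _, y, hi⟩ := hS _ hp
      obtain ⟨j, _, z, hj⟩ := hS _ hq
      exact ((computes_of_item hi).prefix_unique (computes_of_item hj) h).1
  have := InformationTheory.kraft_mcmillan_inequality hU
  simp only [Fintype.card_bool, Nat.cast_ofNat] at this
  refine le_trans ?_ this
  have e : ∑ i ∈ s, U.weight i = ∑ i ∈ s with (U.item i).isSome, U.weight i := by
    refine (Finset.sum_filter_of_ne fun i _ h => ?_).symm
    by_contra h'
    exact h (by simp [weight, Option.not_isSome_iff_eq_none.1 h'])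
  rw [e]
  have hmem : ∀ i ∈ s.filter fun i => (U.item i).isSome, ∃ p y, U.item i = some (p, y) := by
    intro i hi
    obtain ⟨⟨p, y⟩, h⟩ := Option.isSome_iff_exists.1 (Finset.mem_filter.1 hi).2
    exact ⟨p, y, h⟩
  refine (Finset.sum_bij (t := s.biUnion fun i => ((U.item i).map Prod.fst).toFinset)
    (fun i _ => (U.item i).elim [] Prod.fst) ?_ ?_ ?_ ?_).le
  · intro i hi
    obtain ⟨p, y, h⟩ := hmem i hi
    simp only [Finset.mem_biUnion, Option.mem_toFinset, h]
    exact ⟨i, (Finset.mem_filter.1 hi).1, by simp [h]⟩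
  · intro i hi j hj hij
    obtain ⟨p, y, h⟩ := hmem i hi
    obtain ⟨q, z, h'⟩ := hmem j hj
    simp only [h, h', Option.elim] at hij
    subst hij
    exact item_unique h h'
  · intro p hp
    obtain ⟨i, hi, y, h⟩ := hS p hp
    exact ⟨i, by simp [hi, h], by simp [h]⟩
  · intro i hi
    obtain ⟨p, y, h⟩ := hmem i hi
    simp [weight_eq h, h]

open Classical in
/-- The total weight of the first `k` programs whose outputs satisfy `P`. -/
noncomputable def mass (U : PrefixTM) (P : List Bool → Prop) (k : ℕ) : ℝ :=
  ∑ i ∈ Finset.range k, if ∃ p y, U.item i = some (p, y) ∧ P y then U.weight i else 0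

open ENNReal in
/-- There are infinitely many numbers `n` of programs such that the programs for the strings of
length `n` weigh no more than the program with number `n`. -/
theorem IsOptimal.exists_light (hU : U.IsOptimal) (N : ℕ) :
    ∃ n ≥ N, ∃ p y, U.item n = some (p, y) ∧
      ∀ k, U.mass (fun z => z.length = n) k ≤ (1 / 2) ^ p.length := by
  classical
  let W : ℕ → ℝ≥0∞ := fun i => ENNReal.ofReal (U.weight i)
  let hit : ℕ → ℕ → Prop := fun n i => ∃ p y, U.item i = some (p, y) ∧ y.length = n
  let M : ℕ → ℝ≥0∞ := fun n => ∑' i, if hit n i then W i else 0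
  let G : ℕ → Prop := fun n => N ≤ n ∧ (U.item n).isSome
  have hsum : ∑' n, W n ≠ ∞ := by
    refine ne_top_of_le_ne_top ENNReal.one_ne_top (ENNReal.tsum_le_of_sum_range_le fun s => ?_)
    rw [← ENNReal.ofReal_sum_of_nonneg fun i _ => U.weight_nonneg i, ← ENNReal.ofReal_one]
    exact ENNReal.ofReal_le_ofReal (sum_weight_le _)
  have hfin : ∑' n, (if G n then W n else 0) ≠ ∞ :=
    ne_top_of_le_ne_top hsum (ENNReal.tsum_le_tsum fun n => by split <;> simp)
  -- Exchange the sums: program `i` contributes only to the length `n` of its output. If `n ≥ N`,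
  -- then `i ≥ n ≥ N`, so its weight is also counted on the right.
  have hM : ∑' n, (if G n then M n else 0) ≤ ∑' n, if G n then W n else 0 := by
    have e : ∀ n, (if G n then M n else 0) = ∑' i, if G n ∧ hit n i then W i else 0 := by
      intro n
      by_cases h : G n <;> simp [h, M]
    simp only [e]
    rw [ENNReal.tsum_comm]
    refine ENNReal.tsum_le_tsum fun i => ?_
    obtain hi | ⟨⟨p, y⟩, hi⟩ := Option.eq_none_or_eq_some (U.item i)
    · simp [hit, hi]
    · rw [tsum_eq_single y.length]
      · split
        · rename_i h
          have : G i := ⟨h.1.1.trans (length_le_of_item hi), by simp [hi]⟩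
          simp [this]
        · exact zero_le
      · intro n hn
        rw [if_neg]
        rintro ⟨_, q, z, hz, rfl⟩
        rw [hi] at hz
        cases hz
        exact hn rfl
  -- Otherwise `W n < M n` at all `n` in `G`, and the finite sums would contradict `hM`. A program
  -- for `N` zeros shows that `G` is not empty.
  have key : ∃ n, G n ∧ M n ≤ W n := by
    by_contra! h
    obtain ⟨q, d, hq⟩ := hU.exists_computes (List.replicate N false)
    obtain ⟨e, _, he⟩ := HaltsWithin.exists_item hq
    have hG : G (Nat.pair (Encodable.encode q) e) :=
      ⟨by simpa using length_le_of_item he, by simp [he]⟩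
    have hlt : ∑' n, (if G n then W n else 0) < ∑' n, if G n then M n else 0 := by
      refine ENNReal.tsum_lt_tsum hfin (fun n => ?_) (i := Nat.pair (Encodable.encode q) e) ?_
      · split
        · exact (h n ‹_›).le
        · exact le_rfl
      · simp only [hG, if_true]
        exact h _ hG
    exact absurd hM (not_le.2 hlt)
  obtain ⟨n, ⟨hN, hn⟩, hMW⟩ := key
  obtain ⟨⟨p, y⟩, hpy⟩ := Option.isSome_iff_exists.1 hn
  refine ⟨n, hN, p, y, hpy, fun k => ?_⟩
  rw [← weight_eq hpy, ← ENNReal.ofReal_le_ofReal_iff (U.weight_nonneg n)]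
  refine le_trans ?_ hMW
  unfold mass
  rw [ENNReal.ofReal_sum_of_nonneg fun i _ => by split; exacts [U.weight_nonneg i, le_rfl]]
  refine le_trans (le_of_eq ?_) (ENNReal.sum_le_tsum (Finset.range k))
  refine Finset.sum_congr rfl fun i _ => ?_
  by_cases h : hit n i
  · rw [if_pos h, if_pos h]
  · rw [if_neg h, if_neg h, ENNReal.ofReal_zero]

end PrefixTM

/-! ### Binary numerals, dyadic weights and a Shannon–Fano code for the programs of a string. -/

theorem primrec_pow : Primrec₂ fun b n : ℕ => b ^ n :=
  Primrec₂.unpaired'.1 Nat.Primrec.pow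

/-- The value of a binary numeral, highest digit first. -/
def binaryValue (r : List Bool) : ℕ := r.foldl (fun n b => 2 * n + cond b 1 0) 0

theorem binaryValue_append_singleton (r : List Bool) (b : Bool) :
    binaryValue (r ++ [b]) = 2 * binaryValue r + cond b 1 0 := by
  simp [binaryValue]

theorem primrec_binaryValue : Primrec binaryValue :=
  Primrec.list_foldl Primrec.id (Primrec.const 0) (Primrec.nat_add.comp
    (Primrec.nat_mul.comp (Primrec.const 2) (Primrec.fst.comp Primrec.snd))
    (Primrec.cond (Primrec.snd.comp Primrec.snd) (Primrec.const 1) (Primrec.const 0))).to₂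

theorem binaryValue_append (r s : List Bool) :
    binaryValue r * 2 ^ s.length ≤ binaryValue (r ++ s) ∧
      binaryValue (r ++ s) + 1 ≤ (binaryValue r + 1) * 2 ^ s.length := by
  induction s using List.reverseRecOn with
  | nil => simp
  | append_singleton s b ih =>
    rw [← List.append_assoc, binaryValue_append_singleton, List.length_append, List.length_singleton,
      pow_succ]
    have : cond b 1 0 ≤ 1 := by cases b <;> simp
    constructor <;> nlinarith

theorem exists_binaryValue_eq (l : ℕ) : ∀ v, v < 2 ^ l →
    ∃ r : List Bool, r.length = l ∧ binaryValue r = v := by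
  induction l with
  | zero =>
    intro v hv
    obtain rfl : v = 0 := by simpa using hv
    exact ⟨[], rfl, rfl⟩
  | succ l ih =>
    intro v hv
    obtain ⟨r, hr, hv'⟩ := ih (v / 2) (by rw [pow_succ] at hv; omega)
    refine ⟨r ++ [v.bodd], by simp [hr], ?_⟩
    rw [binaryValue_append_singleton, hv', ← Nat.div2_val]
    have := Nat.bodd_add_div2 v
    cases h : v.bodd <;> simp [h] at this ⊢ <;> omega

namespace PrefixTM

variable {U : PrefixTM}

theorem mass_succ (P : List Bool → Prop) (k : ℕ) [Decidable (∃ p y, U.item k = some (p, y) ∧ P y)] :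
    U.mass P (k + 1) =
      U.mass P k + if ∃ p y, U.item k = some (p, y) ∧ P y then U.weight k else 0 := by
  rw [mass, Finset.sum_range_succ, mass]
  congr

theorem mass_mono (P : List Bool → Prop) : Monotone (U.mass P) := by
  classical
  refine monotone_nat_of_le_succ fun k => ?_
  rw [mass_succ]
  have := U.weight_nonneg k
  split <;> linarith

theorem mass_nonneg (P : List Bool → Prop) (k : ℕ) : 0 ≤ U.mass P k := by
  have := U.mass_mono P (Nat.zero_le k)
  simpa [mass] using this

theorem mass_add_weight_le {P : List Bool → Prop} {p y : List Bool} {i k : ℕ}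
    (h : U.item i = some (p, y)) (hy : P y) (hik : i < k) :
    U.mass P i + (1 / 2) ^ p.length ≤ U.mass P k := by
  classical
  have := U.mass_mono P (show i + 1 ≤ k from hik)
  rw [mass_succ, if_pos ⟨p, y, h, hy⟩, weight_eq h] at this
  exact this

variable (U)

/-- The total weight of the first `k` programs for `x` as a dyadic fraction: numerator and binary
logarithm of the denominator. -/
noncomputable def dyadicMass (x : List Bool) (k : ℕ) : ℕ × ℕ :=
  k.rec (0, 0) fun i m =>
    (U.item i).elim m fun q =>
      if q.2 = x then (m.1 * 2 ^ q.1.length + 2 ^ m.2, m.2 + q.1.length) else m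

variable {U}

theorem dyadicMass_spec (x : List Bool) (k : ℕ) :
    U.mass (· = x) k * 2 ^ (U.dyadicMass x k).2 = (U.dyadicMass x k).1 := by
  classical
  induction k with
  | zero => simp [mass, dyadicMass]
  | succ k ih =>
    rw [mass_succ]
    have e : U.dyadicMass x (k + 1) = (U.item k).elim (U.dyadicMass x k) fun q =>
      if q.2 = x then ((U.dyadicMass x k).1 * 2 ^ q.1.length + 2 ^ (U.dyadicMass x k).2,
        (U.dyadicMass x k).2 + q.1.length) else U.dyadicMass x k := rfl
    rw [e]
    obtain hk | ⟨⟨p, y⟩, hk⟩ := Option.eq_none_or_eq_some (U.item k)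
    · simp [hk, ih]
    · by_cases hy : y = x
      · subst hy
        rw [if_pos ⟨p, y, hk, rfl⟩, weight_eq hk]
        simp only [hk, Option.elim, if_true]
        push_cast
        rw [← ih, pow_add]
        have : (1 / 2 : ℝ) ^ p.length * 2 ^ p.length = 1 := by
          rw [← mul_pow]; norm_num
        linear_combination (2 : ℝ) ^ (U.dyadicMass y k).2 * this
      · rw [if_neg (by rintro ⟨q, z, hq, rfl⟩; rw [hk] at hq; cases hq; exact hy rfl)]
        simp [hk, hy, ih]

theorem primrec_dyadicMass : Primrec₂ U.dyadicMass := by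
  refine Primrec.nat_rec' (f := fun x : List Bool × ℕ => x.2) (g := fun _ => ((0, 0) : ℕ × ℕ))
    (h := fun (x : List Bool × ℕ) (y : ℕ × (ℕ × ℕ)) => (U.item y.1).elim y.2 fun q =>
      if q.2 = x.1 then (y.2.1 * 2 ^ q.1.length + 2 ^ y.2.2, y.2.2 + q.1.length) else y.2)
    Primrec.snd (Primrec.const _) ?_
  have h₁ : Primrec fun z : (List Bool × ℕ) × (ℕ × (ℕ × ℕ)) => U.item z.2.1 :=
    U.primrec_item.comp (Primrec.fst.comp Primrec.snd)
  have hm : Primrec fun z : ((List Bool × ℕ) × (ℕ × (ℕ × ℕ))) × (List Bool × List Bool) =>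
      z.1.2.2 := Primrec.snd.comp (Primrec.snd.comp Primrec.fst)
  have hl : Primrec fun z : ((List Bool × ℕ) × (ℕ × (ℕ × ℕ))) × (List Bool × List Bool) =>
      z.2.1.length := Primrec.list_length.comp (Primrec.fst.comp Primrec.snd)
  have h₂ : Primrec₂ fun (z : (List Bool × ℕ) × (ℕ × (ℕ × ℕ))) (q : List Bool × List Bool) =>
      if q.2 = z.1.1 then (z.2.2.1 * 2 ^ q.1.length + 2 ^ z.2.2.2, z.2.2.2 + q.1.length)
      else z.2.2 :=
    Primrec.ite (Primrec.eq.comp (Primrec.snd.comp Primrec.snd)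
      (Primrec.fst.comp (Primrec.fst.comp Primrec.fst)))
      (Primrec.pair (Primrec.nat_add.comp
        (Primrec.nat_mul.comp (Primrec.fst.comp hm) (primrec_pow.comp (Primrec.const 2) hl))
        (primrec_pow.comp (Primrec.const 2) (Primrec.snd.comp hm)))
        (Primrec.nat_add.comp (Primrec.snd.comp hm) hl)) hm
  refine (Primrec.option_casesOn h₁ (Primrec.snd.comp Primrec.snd) h₂).of_eq fun z => ?_
  beta_reduce
  cases U.item z.2.1 <;> rfl

/-- Exact dyadic fractions turn this comparison of reals into a primitive recursive one of integers.
-/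
theorem mass_le_iff (x : List Bool) (k w : ℕ) : U.mass (· = x) k ≤ (1 / 2) ^ w ↔
    (U.dyadicMass x k).1 * 2 ^ w ≤ 2 ^ (U.dyadicMass x k).2 := by
  have h := dyadicMass_spec (U := U) x k
  generalize U.dyadicMass x k = m at h ⊢
  rw [← @Nat.cast_le ℝ]
  push_cast
  rw [← h, one_div, inv_pow, ← one_div, le_div_iff₀ (by positivity)]
  have h2 : (0 : ℝ) < 2 ^ m.2 := by positivity
  rw [show U.mass (· = x) k * 2 ^ m.2 * 2 ^ w = (U.mass (· = x) k * 2 ^ w) * 2 ^ m.2 by ring]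
  constructor
  · intro h'; nlinarith
  · intro h'; exact le_of_mul_le_mul_right (by linarith) h2

/-- The string `r` is a codeword for the program for `x` with number `k`: it denotes a dyadic
subinterval of the interval that is assigned to this program when the programs for `x` get, one
after the other, consecutive intervals of `2 ^ m` times their weight. -/
def IsCodeword (U : PrefixTM) (x : List Bool) (m k : ℕ) (r : List Bool) : Prop :=
  ∃ p, U.item k = some (p, x) ∧ r.length + m = p.length + 1 ∧
    2 ^ (m + r.length) * U.mass (· = x) k ≤ binaryValue r ∧
    binaryValue r ≤ 2 ^ (m + r.length) * U.mass (· = x) k + 1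

/-- Since `|r| = |p| - m + 1`, the interval assigned to `p` is two units of `2 ^ -|r|` long.
Rounding its left end up takes at most one unit and the interval of `r` takes the other, so it ends
before the next assigned interval begins. -/
theorem IsCodeword.lt {x : List Bool} {m k l : ℕ} {r s : List Bool} (hr : U.IsCodeword x m k r)
    (hs : U.IsCodeword x m l s) (hkl : k < l) :
    ((binaryValue r : ℝ) + 1) / 2 ^ r.length ≤ binaryValue s / 2 ^ s.length := by
  obtain ⟨p, hp, hl, _, h₁⟩ := hr
  obtain ⟨q, _, _, h₂, _⟩ := hs
  have h := mass_add_weight_le (P := (· = x)) hp rfl hkl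
  calc ((binaryValue r : ℝ) + 1) / 2 ^ r.length
      ≤ (2 ^ (m + r.length) * U.mass (· = x) k + 2) / 2 ^ r.length :=
        div_le_div_of_nonneg_right (by linarith) (by positivity)
    _ = 2 ^ m * (U.mass (· = x) k + (1 / 2) ^ p.length) := by
      have e : (2 : ℝ) ^ p.length * 2 = 2 ^ r.length * 2 ^ m := by
        rw [← pow_succ, ← pow_add, hl]
      rw [div_eq_iff (by positivity), pow_add, mul_add, add_mul]
      congr 1
      · ring
      · rw [one_div, inv_pow]
        field_simp
        linarith
    _ ≤ 2 ^ m * U.mass (· = x) l := by gcongr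
    _ ≤ binaryValue s / 2 ^ s.length := by
      rw [le_div_iff₀ (by positivity)]
      rw [pow_add] at h₂
      linarith

/-- Codewords of different programs denote disjoint intervals, while a prefix denotes a larger
interval. A decoder may therefore search through all programs; a bound on their mass serves only to
make codewords exist. -/
theorem IsCodeword.unique {x : List Bool} {m k l : ℕ} {r s : List Bool}
    (hr : U.IsCodeword x m k r) (hs : U.IsCodeword x m l s) (h : r <+: s) : k = l ∧ r = s := by
  have hkl : k = l := by
    obtain ⟨t, rfl⟩ := h
    have hb := binaryValue_append r t
    rcases lt_trichotomy k l with h | h | h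
    · have := hr.lt hs h
      rw [div_le_div_iff₀ (by positivity) (by positivity), List.length_append, pow_add] at this
      have h₁ : (binaryValue (r ++ t) : ℝ) + 1 ≤ (binaryValue r + 1) * 2 ^ t.length := by
        exact_mod_cast hb.2
      have h2 : (0 : ℝ) < 2 ^ r.length := by positivity
      nlinarith
    · exact h
    · have := hs.lt hr h
      rw [div_le_div_iff₀ (by positivity) (by positivity), List.length_append, pow_add] at this
      have h₁ : (binaryValue r : ℝ) * 2 ^ t.length ≤ binaryValue (r ++ t) := by
        exact_mod_cast hb.1
      have h2 : (0 : ℝ) < 2 ^ r.length := by positivity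
      nlinarith
  subst hkl
  obtain ⟨p, hp, hl, _⟩ := hr
  obtain ⟨q, hq, hl', _⟩ := hs
  rw [hp] at hq
  cases hq
  exact ⟨rfl, h.eq_of_length (by omega)⟩

/-- The mass bound puts the interval of `p` inside the unit interval, so its left end, rounded up,
is below `2 ^ |r|` and has a numeral of length `|r|`. -/
theorem exists_isCodeword {x p : List Bool} {m k l : ℕ} (hp : U.item k = some (p, x))
    (hkl : k < l) (hm : U.mass (· = x) l ≤ (1 / 2) ^ m) :
    ∃ r, U.IsCodeword x m k r ∧ r.length + m = p.length + 1 := by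
  have h := (mass_add_weight_le (P := (· = x)) hp rfl hkl).trans hm
  have h₀ := U.mass_nonneg (· = x) k
  have hmp : m ≤ p.length := by
    have h₁ : (1 / 2 : ℝ) ^ p.length ≤ (1 / 2) ^ m := by linarith
    exact (pow_le_pow_iff_right_of_lt_one₀ (by norm_num) (by norm_num)).1 h₁
  obtain ⟨n, hn⟩ := Nat.exists_eq_add_of_le hmp
  have e : (2 : ℝ) ^ (m + (n + 1)) * U.mass (· = x) k ≤ 2 ^ (n + 1) - 2 := by
    have e₁ : (2 : ℝ) ^ (m + (n + 1)) * (1 / 2) ^ m = 2 ^ (n + 1) := by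
      rw [pow_add, mul_right_comm, ← mul_pow]; norm_num
    have e₂ : (2 : ℝ) ^ (m + (n + 1)) * (1 / 2) ^ p.length = 2 := by
      rw [← add_assoc, ← hn, pow_succ, mul_right_comm, ← mul_pow]; norm_num
    have h' := mul_le_mul_of_nonneg_left h (show (0 : ℝ) ≤ 2 ^ (m + (n + 1)) by positivity)
    rw [mul_add, e₁, e₂] at h'
    linarith
  set t : ℝ := 2 ^ (m + (n + 1)) * U.mass (· = x) k with ht
  have ht₀ : 0 ≤ t := by positivity
  have hlt := Nat.ceil_lt_add_one ht₀
  obtain ⟨r, hr, hv⟩ := exists_binaryValue_eq (n + 1) ⌈t⌉₊ (by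
    rw [← @Nat.cast_lt ℝ]; push_cast; linarith)
  refine ⟨r, ⟨p, hp, by omega, ?_, ?_⟩, by omega⟩
  · rw [hr, hv]; exact Nat.le_ceil t
  · rw [hr, hv]; exact hlt.le

theorem isCodeword_iff {x : List Bool} {m k : ℕ} {r : List Bool} : U.IsCodeword x m k r ↔
    ∃ p, U.item k = some (p, x) ∧ r.length + m = p.length + 1 ∧
      2 ^ (m + r.length) * (U.dyadicMass x k).1 ≤ binaryValue r * 2 ^ (U.dyadicMass x k).2 ∧
      binaryValue r * 2 ^ (U.dyadicMass x k).2 ≤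
        2 ^ (m + r.length) * (U.dyadicMass x k).1 + 2 ^ (U.dyadicMass x k).2 := by
  unfold IsCodeword
  have h := dyadicMass_spec (U := U) x k
  generalize U.dyadicMass x k = d at h ⊢
  have h2 : (0 : ℝ) < 2 ^ d.2 := by positivity
  refine exists_congr fun p => and_congr_right fun _ => and_congr_right fun _ => and_congr ?_ ?_
  · rw [← @Nat.cast_le ℝ]
    push_cast
    rw [← h, ← mul_assoc, mul_le_mul_iff_left₀ h2]
  · rw [← @Nat.cast_le ℝ]
    push_cast
    rw [← h, ← mul_assoc, ← add_one_mul, mul_le_mul_iff_left₀ h2]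

/-- If the programs for `x` that are found early have small total weight, then they are
compressible given a shortest program for `x`. -/
theorem IsOptimal.complexity_program_le (hU : U.IsOptimal) {w : List Bool → ℕ} (hw : Computable w) :
    ∃ c, ∀ x k, U.mass (· = x) k ≤ (1 / 2) ^ w x → ∀ i p, i < k → U.item i = some (p, x) →
      U.complexity p + w x ≤ p.length + U.complexity x + c := by
  classical
  let find : (List Bool × List Bool) × ℕ → ℕ → Option (List Bool) := fun z k =>
    (U.item k).bind fun q =>
      if q.2 = z.1.1 ∧ z.1.2.length + z.2 = q.1.length + 1 ∧
        2 ^ (z.2 + z.1.2.length) * (U.dyadicMass z.1.1 k).1 ≤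
          binaryValue z.1.2 * 2 ^ (U.dyadicMass z.1.1 k).2 ∧
        binaryValue z.1.2 * 2 ^ (U.dyadicMass z.1.1 k).2 ≤
          2 ^ (z.2 + z.1.2.length) * (U.dyadicMass z.1.1 k).1 + 2 ^ (U.dyadicMass z.1.1 k).2
      then some q.1 else none
  have mem_find : ∀ {x r m k p}, p ∈ find ((x, r), m) k ↔
      U.IsCodeword x m k r ∧ U.item k = some (p, x) := by
    intro x r m k p
    simp only [find, Option.mem_def, Option.bind_eq_some_iff, isCodeword_iff,
      Option.ite_none_right_eq_some, Option.some.injEq, Prod.exists]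
    constructor
    · rintro ⟨q, y, hq, ⟨rfl, h⟩, rfl⟩
      exact ⟨⟨q, hq, h⟩, hq⟩
    · rintro ⟨⟨q, hq, h⟩, hp⟩
      rw [hp] at hq
      cases hq
      exact ⟨p, x, hp, ⟨rfl, h⟩, rfl⟩
  have hfind : Primrec₂ find := by
    refine Primrec.option_bind (U.primrec_item.comp Primrec.snd) ?_
    let Z := (((List Bool × List Bool) × ℕ) × ℕ) × (List Bool × List Bool)
    have hx : Primrec fun z : Z => z.1.1.1.1 :=
      Primrec.fst.comp (Primrec.fst.comp (Primrec.fst.comp Primrec.fst))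
    have hr : Primrec fun z : Z => z.1.1.1.2 :=
      Primrec.snd.comp (Primrec.fst.comp (Primrec.fst.comp Primrec.fst))
    have hm : Primrec fun z : Z => z.1.1.2 :=
      Primrec.snd.comp (Primrec.fst.comp Primrec.fst)
    have hrl := Primrec.list_length.comp hr
    have hd : Primrec fun z : Z => U.dyadicMass z.1.1.1.1 z.1.2 :=
      primrec_dyadicMass.comp hx (Primrec.snd.comp Primrec.fst)
    have h₁ : Primrec fun z : Z => 2 ^ (z.1.1.2 + z.1.1.1.2.length) *
        (U.dyadicMass z.1.1.1.1 z.1.2).1 :=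
      Primrec.nat_mul.comp (primrec_pow.comp (Primrec.const 2) (Primrec.nat_add.comp hm hrl))
        (Primrec.fst.comp hd)
    have h₂ : Primrec fun z : Z => 2 ^ (U.dyadicMass z.1.1.1.1 z.1.2).2 :=
      primrec_pow.comp (Primrec.const 2) (Primrec.snd.comp hd)
    have h₃ := Primrec.nat_mul.comp (primrec_binaryValue.comp hr) h₂
    exact Primrec.ite ((Primrec.eq.comp (Primrec.snd.comp Primrec.snd) hx).and
      ((Primrec.eq.comp (Primrec.nat_add.comp hrl hm)
        (Primrec.succ.comp (Primrec.list_length.comp (Primrec.fst.comp Primrec.snd)))).and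
      ((Primrec.nat_le.comp h₁ h₃).and (Primrec.nat_le.comp h₃ (Primrec.nat_add.comp h₁ h₂)))))
      (Primrec.option_some.comp (Primrec.fst.comp Primrec.snd)) (Primrec.const none)
  -- A shortest program `a` for `x` supplies both `x` and the scale `w x`; the codeword `r` adds
  -- only `|p| - w x + 1` bits.
  let g : List Bool → List Bool →. List Bool := fun a r =>
    (U.eval a).bind fun x => Nat.rfindOpt (find ((x, r), w x))
  have hg : Partrec₂ g := by
    refine (partrec_eval.comp Computable.fst).bind
      (Partrec.rfindOpt (hfind.to_comp.comp ?_ Computable.snd))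
    exact Computable.pair (Computable.pair (Computable.snd.comp Computable.fst)
      (Computable.snd.comp (Computable.fst.comp Computable.fst)))
      (hw.comp (Computable.snd.comp Computable.fst))
  have mem_g : ∀ {a x r p}, U.Computes a x → p ∈ g a r →
      ∃ k, U.IsCodeword x (w x) k r ∧ U.item k = some (p, x) := by
    intro a x r p hx hp
    obtain ⟨y, hy, hp⟩ := Part.mem_bind_iff.1 hp
    obtain rfl := (mem_eval.1 hy).unique hx
    obtain ⟨k, hk⟩ := Nat.rfindOpt_spec hp
    exact ⟨k, mem_find.1 hk⟩
  obtain ⟨j, hj⟩ := hU.exists_prefix_append hg fun a x hx r s y z hy hz hrs => by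
    obtain ⟨k, hk, _⟩ := mem_g hx hy
    obtain ⟨l, hl, _⟩ := mem_g hx hz
    exact (hk.unique hl hrs).2
  refine ⟨j.length + 1, fun x k hk i p hik hp => ?_⟩
  obtain ⟨r, hr, hl⟩ := exists_isCodeword hp hik hk
  obtain ⟨a, ha, hx⟩ := hU.exists_shortest x
  have hpg : p ∈ g a r := by
    refine Part.mem_bind_iff.2 ⟨x, mem_eval.2 hx, ?_⟩
    obtain ⟨q, hq⟩ := Part.dom_iff_mem.1 (Nat.rfindOpt_dom.2 ⟨i, p, mem_find.2 ⟨hr, hp⟩⟩)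
    obtain ⟨l, hl⟩ := Nat.rfindOpt_spec hq
    obtain ⟨hl, hl'⟩ := mem_find.1 hl
    obtain rfl := (hr.unique hl List.prefix_rfl).1
    rw [hp] at hl'
    cases hl'
    exact hq
  have := complexity_le (hj a x r p hx hpg)
  simp only [List.length_append] at this
  omega

end PrefixTM

/-! ### Computable sums and searches, and bounds on codes and logarithms. -/

theorem computable_sum_range {f : ℕ → ℕ} (hf : Computable f) :
    Computable fun n => ∑ i ∈ Finset.range n, f i := by
  have : Computable fun n : ℕ => Nat.rec (motive := fun _ => ℕ) 0 (fun i s => s + f i) n :=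
    Computable.nat_rec Computable.id (Computable.const 0)
      (Primrec.nat_add.to_comp.comp (Computable.snd.comp Computable.snd)
        (hf.comp (Computable.fst.comp Computable.snd))).to₂
  refine this.of_eq fun n => ?_
  induction n with
  | zero => rfl
  | succ n ih => rw [Finset.sum_range_succ, ← ih]

/-- Unbounded search that always succeeds is computable. -/
theorem exists_computable_search {α : Type*} [Primcodable α] {P : α → ℕ → Bool}
    (hP : Computable₂ P) (h : ∀ a, ∃ n, P a n = true) :
    ∃ f : α → ℕ, Computable f ∧ ∀ a, P a (f a) = true := by
  have hdom : ∀ a, (Nat.rfind fun n => (Part.some (P a n))).Dom := by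
    intro a
    obtain ⟨n, hn⟩ := h a
    exact Nat.rfind_dom.2 ⟨n, by simp [hn], fun _ => trivial⟩
  refine ⟨fun a => (Nat.rfind fun n => (Part.some (P a n))).get (hdom a), ?_, fun a => ?_⟩
  · exact (Partrec.rfind (p := fun a n => Part.some (P a n)) hP.partrec₂).of_eq fun a =>
      (Part.some_get (hdom a)).symm
  · have := Nat.rfind_spec (Part.get_mem (hdom a))
    exact (Part.mem_some_iff.1 this).symm

theorem pair_le_pair {a b c d : ℕ} (h₁ : a ≤ c) (h₂ : b ≤ d) : Nat.pair a b ≤ Nat.pair c d :=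
  le_trans ((StrictMono.monotone fun _ _ h => Nat.pair_lt_pair_left b h) h₁)
    ((StrictMono.monotone fun _ _ h => Nat.pair_lt_pair_right c h) h₂)

/-- Turns a bound on the length of a program into one on its code, hence a time bound into a bound
on program numbers. -/
theorem exists_encode_bound :
    ∃ E : ℕ → ℕ, Computable E ∧ ∀ (p : List Bool) (n : ℕ), p.length ≤ n → Encodable.encode p ≤ E n := by
  let E : ℕ → ℕ := fun n => Nat.rec (motive := fun _ => ℕ) 0 (fun _ e => Nat.succ (Nat.pair 1 e)) n
  refine ⟨E, (Primrec.nat_rec₁ 0 (Primrec.succ.comp (Primrec₂.natPair.comp (Primrec.const 1)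
    Primrec.snd)).to₂).to_comp, fun p => ?_⟩
  induction p with
  | nil => intro n _; simp
  | cons b p ih =>
    rintro (_ | n) h
    · simp at h
    · have h₁ := ih n (by simpa using h)
      have h₂ : Encodable.encode b ≤ 1 := by cases b <;> decide
      rw [Encodable.encode_list_cons]
      exact Nat.succ_le_succ (pair_le_pair h₂ h₁)

theorem eventually_log_add_lt (c : ℕ) : ∀ᶠ n : ℕ in atTop, 2 * Nat.log 2 (n + 1) + c < n := by
  have h : ∀ n : ℕ, 4 ≤ Nat.log 2 (n + 1) → 2 * Nat.log 2 (n + 1) + c < n ∨ n ≤ 4 * c + 16 := by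
    intro n hn
    have h₁ : 2 ^ Nat.log 2 (n + 1) ≤ n + 1 := Nat.pow_log_le_self 2 (by omega)
    have h₂ : ∀ m : ℕ, 4 ≤ m → 4 * m ≤ 2 ^ m := by
      intro m hm
      induction m, hm using Nat.le_induction with
      | base => norm_num
      | succ m _ ih => rw [pow_succ]; omega
    have := h₂ _ hn
    omega
  filter_upwards [eventually_gt_atTop (4 * c + 16)] with n hn
  refine (h n ?_).resolve_right (by omega)
  exact (Nat.le_log_iff_pow_le (by norm_num) (by omega)).2 (by omega)

/-! ### Deep strings, and the Busy Beaver bound. -/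

namespace PrefixTM

variable {U : PrefixTM}

theorem sum_mass_le (n k : ℕ) :
    ∑ f : Fin n → Bool, U.mass (· = List.ofFn f) k ≤ U.mass (fun z => z.length = n) k := by
  classical
  unfold mass
  rw [Finset.sum_comm]
  refine Finset.sum_le_sum fun i _ => ?_
  obtain hi | ⟨⟨p, y⟩, hi⟩ := Option.eq_none_or_eq_some (U.item i)
  · simp [hi]
  · by_cases hy : y.length = n
    · subst hy
      rw [if_pos ⟨p, y, hi, rfl⟩, Finset.sum_eq_single y.get]
      · split
        · exact le_rfl
        · exact U.weight_nonneg i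
      · intro f _ hf
        rw [if_neg]
        rintro ⟨q, z, hz, rfl⟩
        rw [hi] at hz
        have e : y = List.ofFn f := (Prod.mk.inj (Option.some.inj hz)).2
        exact hf (List.ofFn_injective (e.symm.trans (List.ofFn_get y).symm))
      · simp
    · rw [if_neg (by rintro ⟨q, z, hz, rfl⟩; rw [hi] at hz; cases hz; exact hy rfl)]
      refine (Finset.sum_eq_zero fun f _ => if_neg ?_).le
      rintro ⟨q, z, hz, rfl⟩
      rw [hi] at hz
      rw [(Prod.mk.inj (Option.some.inj hz)).2] at hy
      exact hy List.length_ofFn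

/-- The lightest of the `2 ^ n` strings of length `n` is at most as heavy as their average. -/
theorem exists_light_string {n k v : ℕ} (h : U.mass (fun z => z.length = n) k ≤ (1 / 2) ^ v) :
    ∃ x : List Bool, x.length = n ∧ U.mass (· = x) k ≤ (1 / 2) ^ (n + v) := by
  by_contra! hx
  have h₁ : ∑ f : Fin n → Bool, (1 / 2 : ℝ) ^ (n + v) <
      ∑ f : Fin n → Bool, U.mass (· = List.ofFn f) k :=
    Finset.sum_lt_sum_of_nonempty Finset.univ_nonempty fun f _ => hx _ (List.length_ofFn)
  have h₂ : ∑ f : Fin n → Bool, (1 / 2 : ℝ) ^ (n + v) = (1 / 2) ^ v := by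
    rw [Finset.sum_const, Finset.card_univ, Fintype.card_fun, Fintype.card_bool, Fintype.card_fin,
      nsmul_eq_mul, pow_add, ← mul_assoc]
    push_cast
    rw [← mul_pow]
    norm_num
  have := sum_mass_le (U := U) n k
  linarith

/-- A string of length `n` of small weight can be found effectively. -/
theorem IsOptimal.exists_light_simple (hU : U.IsOptimal) {v h : ℕ → ℕ} (hv : Computable v)
    (hh : Computable h) :
    ∃ c, ∀ n, (∀ k, U.mass (fun z => z.length = n) k ≤ (1 / 2) ^ v n) →
      ∃ x : List Bool, x.length = n ∧ U.mass (· = x) (h n) ≤ (1 / 2) ^ (n + v n) ∧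
        U.complexity x ≤ 2 * Nat.log 2 (n + 1) + c := by
  classical
  let find : (ℕ × ℕ) × ℕ → List Bool → Option (List Bool) := fun z x =>
    if x.length = z.1.1 ∧ (U.dyadicMass x z.1.2).1 * 2 ^ z.2 ≤ 2 ^ (U.dyadicMass x z.1.2).2
    then some x else none
  have hfind : Primrec₂ find := by
    let Z := ((ℕ × ℕ) × ℕ) × List Bool
    have hd : Primrec fun z : Z => U.dyadicMass z.2 z.1.1.2 :=
      primrec_dyadicMass.comp Primrec.snd (Primrec.snd.comp (Primrec.fst.comp Primrec.fst))
    exact Primrec.ite ((Primrec.eq.comp (Primrec.list_length.comp Primrec.snd)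
      (Primrec.fst.comp (Primrec.fst.comp Primrec.fst))).and
      (Primrec.nat_le.comp (Primrec.nat_mul.comp (Primrec.fst.comp hd)
        (primrec_pow.comp (Primrec.const 2) (Primrec.snd.comp Primrec.fst)))
        (primrec_pow.comp (Primrec.const 2) (Primrec.snd.comp hd))))
      (Primrec.option_some.comp Primrec.snd) (Primrec.const none)
  have mem_find : ∀ {n k w x y}, y ∈ find ((n, k), w) x ↔
      x = y ∧ x.length = n ∧ U.mass (· = x) k ≤ (1 / 2) ^ w := by
    intro n k w x y
    simp only [find, Option.mem_def, Option.ite_none_right_eq_some, Option.some.injEq, mass_le_iff]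
    tauto
  -- The search is computable from `n` alone, so the string found is as simple as `n` up to a
  -- constant.
  let search : ℕ → ℕ → Option (List Bool) := fun n k =>
    (Encodable.decode k : Option (List Bool)).bind (find ((n, h n), n + v n))
  have hsearch : Computable₂ search := by
    refine Computable.option_bind (Computable.decode.comp Computable.snd)
      (hfind.to_comp.comp ?_ Computable.snd)
    have hn : Computable fun z : (ℕ × ℕ) × List Bool => z.1.1 := Computable.fst.comp Computable.fst
    exact Computable.pair (Computable.pair hn (hh.comp hn))
      (Primrec.nat_add.to_comp.comp hn (hv.comp hn))
  obtain ⟨c₁, hc₁⟩ := hU.complexity_map_le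
    (F := fun y : List Bool => Nat.rfindOpt (search (y.length - 1)))
    (Partrec.rfindOpt (hsearch.comp ((Primrec.nat_sub.comp Primrec.list_length
      (Primrec.const 1)).to_comp.comp Computable.fst) Computable.snd))
  obtain ⟨c₂, hc₂⟩ := hU.complexity_unary_le
  refine ⟨c₁ + c₂, fun n hn => ?_⟩
  obtain ⟨x, hx, hm⟩ := exists_light_string (hn (h n))
  have hex : ∃ k x, x ∈ search n k :=
    ⟨Encodable.encode x, x, Option.bind_eq_some_iff.2 ⟨x, by simp, mem_find.2 ⟨rfl, hx, hm⟩⟩⟩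
  obtain ⟨y, hy⟩ := Part.dom_iff_mem.1 (Nat.rfindOpt_dom.2 hex)
  obtain ⟨k, hk⟩ := Nat.rfindOpt_spec hy
  obtain ⟨z, _, hz⟩ := Option.bind_eq_some_iff.1 hk
  obtain ⟨rfl, hz, hm⟩ := mem_find.1 hz
  refine ⟨z, hz, hm, ?_⟩
  have h₁ := hc₁ (unary n) z (by simpa using hy)
  have h₂ := hc₂ n
  omega

theorem lt_logicalDepth {b D : ℕ} {x : List Bool}
    (h : ∀ p d, d ≤ D → p.length ≤ U.complexity p + b → ¬ U.HaltsWithin p d x) :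
    (D : ℕ∞) < U.logicalDepth b x := by
  have : ((D + 1 : ℕ) : ℕ∞) ≤ U.logicalDepth b x := by
    refine le_iInf₂ fun d ⟨p, hp, hd⟩ => ?_
    by_contra hlt
    rw [not_le, Nat.cast_lt] at hlt
    exact h p d (by omega) hp hd
  exact lt_of_lt_of_le (by exact_mod_cast Nat.lt_succ_self D) this

theorem logicalDepth_le {b d : ℕ} {x p : List Bool} (hp : p.length ≤ U.complexity p + b)
    (h : U.HaltsWithin p d x) : U.logicalDepth b x ≤ d :=
  iInf₂_le_of_le d ⟨p, hp, h⟩ le_rfl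

/-- Strings that are simple but have no short fast programs are deep. -/
theorem IsOptimal.exists_deep (hU : U.IsOptimal) {v : ℕ → ℕ} (hv : Computable v) :
    ∃ c₁, ∀ h : ℕ → ℕ, Computable h → ∃ c₂, ∀ n,
      (∀ k, U.mass (fun z => z.length = n) k ≤ (1 / 2) ^ v n) →
      ∃ x : List Bool, x.length = n ∧ U.complexity x ≤ 2 * Nat.log 2 (n + 1) + c₂ ∧
        ∀ b, b + U.complexity x + c₁ < n + v n → (h n : ℕ∞) < U.logicalDepth b x := by
  -- The loss `c₁` in significance is fixed before `h`, so the gap in `exists_drop` does not depend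
  -- on `h`; only the bound on `K(x)` does.
  obtain ⟨c₁, hc₁⟩ := hU.complexity_program_le (w := fun x => x.length + v x.length)
    (Primrec.nat_add.to_comp.comp Computable.list_length (hv.comp Computable.list_length))
  obtain ⟨E, hE, hE'⟩ := exists_encode_bound
  refine ⟨c₁, fun h hh => ?_⟩
  obtain ⟨c₂, hc₂⟩ := hU.exists_light_simple hv
    -- A program that halts within `h n` steps has length at most `h n + 1`, so its number is below
    -- this bound.
    (h := fun n => Nat.pair (E (h n + 1)) (h n) + 1)
    (Computable.succ.comp (Primrec₂.natPair.to_comp.comp (hE.comp (Computable.succ.comp hh)) hh))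
  refine ⟨c₂, fun n hn => ?_⟩
  obtain ⟨x, rfl, hm, hK⟩ := hc₂ n hn
  refine ⟨x, rfl, hK, fun b hb => lt_logicalDepth fun p d hd hp hx => ?_⟩
  obtain ⟨e, he, hi⟩ := hx.exists_item
  have hlt : Nat.pair (Encodable.encode p) e < Nat.pair (E (h x.length + 1)) (h x.length) + 1 :=
    Nat.lt_succ_of_le (pair_le_pair
      (hE' p _ (hx.length_le.trans (by omega))) (he.trans hd))
  have := hc₁ x _ hm _ p hlt hi
  omega

theorem HaltsWithin.exists_isRunningTime {p y : List Bool} {d : ℕ} (h : U.HaltsWithin p d y) :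
    ∃ e, U.IsRunningTime p e ∧ U.HaltsWithin p e y := by
  classical
  have hex : ∃ e y, U.HaltsWithin p e y := ⟨d, y, h⟩
  refine ⟨Nat.find hex, ⟨Nat.find_spec hex, fun e he => Nat.find_min' hex he⟩, ?_⟩
  obtain ⟨z, hz⟩ := Nat.find_spec hex
  rwa [Computes.unique ⟨d, h⟩ ⟨_, hz⟩]

/-- The supremum is a genuine bound because there are only finitely many programs of length at most
`n`. -/
theorem le_busyBeaver {p : List Bool} {d n : ℕ} (h : U.IsRunningTime p d) (hp : p.length ≤ n) :
    d ≤ U.busyBeaver n := by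
  classical
  refine le_csSup (Set.Finite.bddAbove ?_) ⟨p, hp, h⟩
  have hfin : {p : List Bool | p.length ≤ n}.Finite := List.finite_length_le Bool n
  have : {d : ℕ | ∃ p : List Bool, p.length ≤ n ∧ U.IsRunningTime p d} ⊆
      (fun p => sInf {e : ℕ | ∃ y, U.HaltsWithin p e y}) '' {p : List Bool | p.length ≤ n} := by
    rintro d ⟨p, hp, hd⟩
    exact ⟨p, hp, hd.csInf_eq⟩
  exact (hfin.image _).subset this

theorem IsOptimal.exists_complexity_bound (hU : U.IsOptimal) :
    ∃ r : ℕ → ℕ, ((fun n => (r n : ℝ)) =O[atTop] fun n => Real.logb 2 (n : ℝ)) ∧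
      ∀ x, U.complexity x ≤ x.length + r x.length := by
  obtain ⟨c₁, hc₁⟩ := hU.complexity_le_add_unary
  obtain ⟨c₂, hc₂⟩ := hU.complexity_unary_le
  refine ⟨fun n => 2 * Nat.log 2 (n + 1) + (c₁ + c₂), ?_, fun x => ?_⟩
  -- For `n ≥ 2`, `n + 1 ≤ n ^ 2` gives `Nat.log 2 (n + 1) ≤ 2 * logb 2 n`, and `1 ≤ logb 2 n`
  -- absorbs the constants.
  · refine IsBigO.of_bound (4 + (c₁ + c₂)) ?_
    filter_upwards [eventually_ge_atTop 2] with n hn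
    have hn' : (2 : ℝ) ≤ n := by exact_mod_cast hn
    have h₁ : (1 : ℝ) ≤ Real.logb 2 n := by
      rw [Real.le_logb_iff_rpow_le (by norm_num) (by linarith)]
      simpa using hn'
    have h₂ : (Nat.log 2 (n + 1) : ℝ) ≤ 2 * Real.logb 2 n := by
      rw [← Real.logb_rpow_eq_mul_logb_of_pos (by linarith),
        Real.le_logb_iff_rpow_le (by norm_num) (by positivity), Real.rpow_natCast]
      have h₃ : 2 ^ Nat.log 2 (n + 1) ≤ n + 1 := Nat.pow_log_le_self 2 (by omega)
      have h₄ : (2 : ℝ) ^ Nat.log 2 (n + 1) ≤ n + 1 := by exact_mod_cast h₃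
      have h₅ : (n : ℝ) ^ (2 : ℝ) = n * n := by rw [Real.rpow_two, sq]
      rw [h₅]
      nlinarith
    rw [Real.norm_of_nonneg (by positivity), Real.norm_of_nonneg (by linarith)]
    push_cast
    have h₆ : (0 : ℝ) ≤ (c₁ + c₂) := by positivity
    nlinarith
  · have h₁ := hc₁ x
    have h₂ := hc₂ x.length
    dsimp only
    omega

theorem IsOptimal.shortestProgramTime_le (hU : U.IsOptimal) {x : List Bool} {n : ℕ}
    (h : U.complexity x ≤ n) : U.shortestProgramTime x ≤ (U.busyBeaver n : ℕ∞) := by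
  obtain ⟨p, hp, d, hd⟩ := hU.exists_shortest x
  obtain ⟨e, he, hx⟩ := hd.exists_isRunningTime
  exact (iInf₂_le_of_le e ⟨p, hp, hx⟩ le_rfl).trans
    (by exact_mod_cast le_busyBeaver he (hp.trans_le h))

/-- For some strings of each large length the depth at a fixed significance exceeds a given
computable function. -/
theorem IsOptimal.eventually_deep (hU : U.IsOptimal) (b : ℕ) {h : ℕ → ℕ} (hh : Computable h) :
    ∀ᶠ n in atTop, ∃ x : List Bool, x.length = n ∧ (h n : ℕ∞) < U.logicalDepth b x := by
  obtain ⟨c₁, hc₁⟩ := hU.exists_deep (v := fun _ => 0) (Computable.const 0)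
  obtain ⟨c₂, hc₂⟩ := hc₁ h hh
  filter_upwards [eventually_log_add_lt (b + c₁ + c₂)] with n hn
  -- For `v = 0` the weight hypothesis is Kraft's inequality.
  obtain ⟨x, hx, hK, hd⟩ := hc₂ n fun k => by
    refine le_trans ?_ ((sum_weight_le (U := U) (Finset.range k)).trans (by norm_num))
    exact Finset.sum_le_sum fun i _ => by
      split
      · exact le_rfl
      · exact U.weight_nonneg i
  exact ⟨x, hx, hd b (by omega)⟩

/-- There are strings whose depth drops from incomputable to computable when the significance is
increased by a constant. -/
theorem IsOptimal.exists_drop (hU : U.IsOptimal) (c : ℕ) :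
    ∃ (D : ℕ) (G : ℕ → ℕ), Computable G ∧ ∀ h : ℕ → ℕ, Computable h → ∀ N, ∃ n ≥ N,
      ∃ (x : List Bool) (b : ℕ), x.length = n ∧ c ≤ b ∧ (h n : ℕ∞) < U.logicalDepth b x ∧
        U.logicalDepth (b + D) x ≤ G n := by
  classical
  let v : ℕ → ℕ := fun n => (U.item n).elim 0 fun q => q.1.length
  have hv : Primrec v := by
    refine (Primrec.option_casesOn U.primrec_item (Primrec.const 0)
      (Primrec.list_length.comp (Primrec.fst.comp Primrec.snd)).to₂).of_eq fun n => ?_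
    simp only [v]
    cases U.item n <;> rfl
  obtain ⟨c₀, hc₀⟩ := hU.complexity_output_le
  obtain ⟨c₁, hc₁⟩ := hU.exists_deep hv.to_comp
  obtain ⟨E, hE, hE'⟩ := exists_encode_bound
  -- The number of a program is used as the length of the string that follows it: the program with
  -- number `n` serves as a self-delimiting description of `n`.
  have hL : Partrec fun a : List Bool =>
      Nat.rfind fun n => Part.some (decide ((U.item n).map Prod.fst = some a)) := by
    refine Partrec.rfind (Primrec.to_comp ?_).partrec
    exact (Primrec.eq.comp (Primrec.option_map (U.primrec_item.comp Primrec.snd)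
      (Primrec.fst.comp Primrec.snd).to₂) (Primrec.option_some.comp Primrec.fst)).decide
  obtain ⟨i, hi⟩ := hU.exists_literal hL
  have literal : ∀ x p y, U.item x.length = some (p, y) → U.Computes (i ++ (p ++ x)) x := by
    intro x p y h
    refine hi p y x (computes_of_item h) ?_
    have hdom : (Nat.rfind fun n => Part.some (decide ((U.item n).map Prod.fst = some p))).Dom :=
      Nat.rfind_dom.2 ⟨x.length, by simp [h], fun _ => trivial⟩
    obtain ⟨m, hm⟩ := Part.dom_iff_mem.1 hdom
    have hm' := Nat.rfind_spec hm
    simp only [Part.mem_some_iff, true_eq_decide_iff, Option.map_eq_some_iff] at hm'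
    obtain ⟨⟨q, z⟩, hq, rfl⟩ := hm'
    rwa [item_unique h hq]
  -- The search looks for a program for `x` no longer than the literal one. If `|x|` is not the
  -- number of a program, any program for `x` is accepted, which makes the search total.
  let P : List Bool → ℕ → Bool := fun x k =>
    (U.item k).elim false fun q => decide (q.2 = x ∧
      (U.item x.length = none ∨ q.1.length ≤ i.length + v x.length + x.length))
  have hP : Computable₂ P := by
    have hx : Primrec fun z : (List Bool × ℕ) × (List Bool × List Bool) => z.1.1 :=
      Primrec.fst.comp Primrec.fst
    have hxl := Primrec.list_length.comp hx
    have h₁ : Primrec₂ fun (z : List Bool × ℕ) (q : List Bool × List Bool) => decide (q.2 = z.1 ∧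
      (U.item z.1.length = none ∨ q.1.length ≤ i.length + v z.1.length + z.1.length)) :=
      PrimrecPred.decide ((Primrec.eq.comp (Primrec.snd.comp Primrec.snd) hx).and
        ((Primrec.eq.comp (U.primrec_item.comp hxl) (Primrec.const none)).or
        (Primrec.nat_le.comp (Primrec.list_length.comp (Primrec.fst.comp Primrec.snd))
          (Primrec.nat_add.comp (Primrec.nat_add.comp (Primrec.const _) (hv.comp hxl)) hxl))))
    refine ((Primrec.option_casesOn (U.primrec_item.comp Primrec.snd)
      (Primrec.const false) h₁).of_eq fun z => ?_).to_comp
    simp only [P]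
    cases U.item z.2 <;> rfl
  have hPex : ∀ x, ∃ k, P x k = true := by
    intro x
    obtain hx | ⟨⟨p, y⟩, hx⟩ := Option.eq_none_or_eq_some (U.item x.length)
    · obtain ⟨q, d, hq⟩ := hU.exists_computes x
      obtain ⟨e, _, he⟩ := hq.exists_item
      exact ⟨Nat.pair (Encodable.encode q) e, by simp [P, he, hx]⟩
    · obtain ⟨d, hq⟩ := literal x p y hx
      obtain ⟨e, _, he⟩ := hq.exists_item
      refine ⟨Nat.pair (Encodable.encode (i ++ (p ++ x))) e, ?_⟩
      simp only [P, he, hx, v, Option.elim, List.length_append, decide_eq_true_eq, true_and]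
      right
      omega
  obtain ⟨t, ht, hPt⟩ := exists_computable_search hP hPex
  -- A sum over all codes up to `E n` dominates `t` on all strings of length `n`.
  let G : ℕ → ℕ := fun n => ∑ m ∈ Finset.range (E n + 1),
    t ((Encodable.decode m : Option (List Bool)).getD [])
  have hG : Computable G :=
    (computable_sum_range (ht.comp (Primrec.option_getD.comp Primrec.decode
      (Primrec.const [])).to_comp)).comp (Computable.succ.comp hE)
  have ht_le : ∀ x : List Bool, t x ≤ G x.length := by
    intro x
    have : t x = t ((Encodable.decode (Encodable.encode x) : Option (List Bool)).getD []) := by simp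
    rw [this]
    exact Finset.single_le_sum
      (f := fun m => t ((Encodable.decode m : Option (List Bool)).getD [])) (fun _ _ => Nat.zero_le _)
      (Finset.mem_range.2 (Nat.lt_succ_of_le (hE' x _ le_rfl)))
  -- The program `p` found has `|p| ≤ |i| + |u| + n`, and `K(x) ≤ K(p) + c₀`. With `b = n + |u| -
  -- K(x) - c₁ - 1` this gives `|p| ≤ K(p) + b + D`.
  refine ⟨i.length + c₁ + 1 + c₀, G, hG, fun h hh N => ?_⟩
  obtain ⟨c₂, hc₂⟩ := hc₁ h hh
  obtain ⟨N', hN'⟩ := eventually_atTop.1 (eventually_log_add_lt (c + 1 + c₁ + c₂))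
  obtain ⟨n, hn, u, y, hu, hm⟩ := hU.exists_light (max N N')
  have hvn : v n = u.length := by simp [v, hu]
  obtain ⟨x, rfl, hK, hdeep⟩ := hc₂ n (by rwa [hvn])
  have hlarge := hN' x.length (le_trans (le_max_right _ _) hn)
  -- The significance is the largest one allowed by `hdeep`. As `K(x)` is logarithmic in the length,
  -- `hlarge` keeps it at least `c`, so no subtraction is truncated.
  refine ⟨x.length, le_trans (le_max_left _ _) hn, x,
    x.length + u.length - U.complexity x - c₁ - 1, rfl, by omega, hdeep _ (by omega), ?_⟩
  have hPx := hPt x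
  obtain hk | ⟨⟨p, z⟩, hk⟩ := Option.eq_none_or_eq_some (U.item (t x))
  · simp [P, hk] at hPx
  · simp only [P, hk, Option.elim, decide_eq_true_eq, hu, reduceCtorEq, false_or, hvn] at hPx
    obtain ⟨rfl, hlen⟩ := hPx
    have hp := hc₀ p z (computes_of_item hk)
    refine (logicalDepth_le (p := p) (by omega) (haltsWithin_of_item hk)).trans ?_
    exact_mod_cast (Nat.unpair_right_le _).trans (ht_le z)

/-- There are strings whose depth drops from incomputable to computable when the significance is
increased by one. -/
theorem IsOptimal.exists_drop_one (hU : U.IsOptimal) (c : ℕ) :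
    ∃ G : ℕ → ℕ, Computable G ∧ ∀ h : ℕ → ℕ, Computable h → ∀ N, ∃ n ≥ N,
      ∃ (x : List Bool) (b : ℕ), x.length = n ∧ c ≤ b ∧ (h n : ℕ∞) < U.logicalDepth b x ∧
        U.logicalDepth (b + 1) x ≤ G n := by
  obtain ⟨D, G, hG, hD⟩ := hU.exists_drop c
  induction D generalizing G with
  | zero =>
    obtain ⟨n, _, x, b, _, _, h₁, h₂⟩ := hD G hG 0
    exact absurd h₁ (not_lt.2 h₂)
  | succ D ih =>
    -- If `G` fails for a drop by one, some computable `h₀` has the property that depth above `h₀`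
    -- stays above `G` at the next level. As the depth at level `b + D + 1` is at most `G`, the
    -- depth at level `b + D` is at most `h₀`. So `h₀` replaces `G` with a gap smaller by one.
    by_cases H : ∀ h : ℕ → ℕ, Computable h → ∀ N, ∃ n ≥ N,
      ∃ (x : List Bool) (b : ℕ), x.length = n ∧ c ≤ b ∧ (h n : ℕ∞) < U.logicalDepth b x ∧
        U.logicalDepth (b + 1) x ≤ G n
    · exact ⟨G, hG, H⟩
    · push Not at H
      obtain ⟨h₀, hh₀, N₀, H⟩ := H
      refine ih h₀ hh₀ fun h hh N => ?_
      obtain ⟨n, hn, x, b, hx, hb, h₁, h₂⟩ := hD h hh (max N N₀)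
      refine ⟨n, le_trans (le_max_left _ _) hn, x, b, hx, hb, h₁, ?_⟩
      by_contra! hlt
      exact absurd h₂ (not_le.2 (H n (le_trans (le_max_right _ _) hn) x (b + D) hx (by omega) hlt))

/-! ### Comparison with shortest programs, and sequences that work for all computable functions. -/

theorem logicalDepth_anti {b b' : ℕ} (h : b ≤ b') (x : List Bool) :
    U.logicalDepth b' x ≤ U.logicalDepth b x :=
  le_iInf₂ fun _ ⟨_, hp, hd⟩ => logicalDepth_le (hp.trans (by omega)) hd

/-- A shortest program `p` for `x` is incompressible up to a constant: `|p| = K(x) ≤ K(p) + c`. -/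
theorem IsOptimal.exists_logicalDepth_le_shortestProgramTime (hU : U.IsOptimal) :
    ∃ c, ∀ b x, c ≤ b → U.logicalDepth b x ≤ U.shortestProgramTime x := by
  obtain ⟨c, hc⟩ := hU.complexity_output_le
  refine ⟨c, fun b x hb => le_iInf₂ fun d ⟨p, hp, hd⟩ => logicalDepth_le ?_ hd⟩
  have := hc p x ⟨d, hd⟩
  omega

/-- There is a sequence of strings whose depth at a fixed significance eventually exceeds every
computable function. -/
theorem IsOptimal.exists_deep_sequence (hU : U.IsOptimal) (b : ℕ) :
    ∃ x : ℕ → List Bool, (∀ n, (x n).length = n) ∧ ∀ h : ℕ → ℕ, Computable h →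
      ∀ᶠ n in atTop, (h n : ℕ∞) < U.logicalDepth b (x n) := by
  -- A deepest string of each length is at least as deep as the witness for any particular `h`.
  have hmax : ∀ n, ∃ x : List Bool, x.length = n ∧
      ∀ y : List Bool, y.length = n → U.logicalDepth b y ≤ U.logicalDepth b x := fun n =>
    Set.exists_max_image {x : List Bool | x.length = n} (U.logicalDepth b)
      (List.finite_length_eq Bool n) ⟨List.replicate n false, by simp⟩
  choose x hx hmax using hmax
  refine ⟨x, hx, fun h hh => ?_⟩
  filter_upwards [hU.eventually_deep b hh] with n ⟨y, hy, hd⟩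
  exact hd.trans_le (hmax n y hy)

/-- Provides a candidate of every length for the choice in `exists_drop_sequence`: at a level beyond
the length of some program found for `n` zeros, the depth is bounded by the search. -/
theorem IsOptimal.exists_computable_depth_bound (hU : U.IsOptimal) :
    ∃ t : ℕ → ℕ, Computable t ∧ ∀ n, ∃ b, ∀ b' ≥ b,
      U.logicalDepth b' (List.replicate n false) ≤ t n := by
  let P : ℕ → ℕ → Bool := fun n k => decide ((U.item k).map Prod.snd = some (List.replicate n false))
  have hrep : Primrec fun n : ℕ => List.replicate n false := by
    refine (Primrec.list_map Primrec.list_range (Primrec.const false).to₂).of_eq fun n => ?_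
    simp [List.map_const']
  have hP : Primrec₂ P :=
    (Primrec.eq.comp (Primrec.option_map (U.primrec_item.comp Primrec.snd)
      (Primrec.snd.comp Primrec.snd).to₂)
      (Primrec.option_some.comp (hrep.comp Primrec.fst))).decide
  obtain ⟨t, ht, hPt⟩ := exists_computable_search hP.to_comp fun n => by
    obtain ⟨p, d, hp⟩ := hU.exists_computes (List.replicate n false)
    obtain ⟨e, _, he⟩ := hp.exists_item
    exact ⟨Nat.pair (Encodable.encode p) e, by simp [P, he]⟩
  refine ⟨t, ht, fun n => ?_⟩
  have := hPt n
  simp only [P, decide_eq_true_eq, Option.map_eq_some_iff] at this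
  obtain ⟨⟨p, y⟩, hp, rfl⟩ := this
  refine ⟨p.length, fun b' hb' => (logicalDepth_le (p := p) (by omega)
    (haltsWithin_of_item hp)).trans ?_⟩
  exact_mod_cast Nat.unpair_right_le _

/-- There is a sequence of strings, and of significances, such that the depth has no computable
bound, whereas it has one if the significances are increased by one. -/
theorem IsOptimal.exists_drop_sequence (hU : U.IsOptimal) (c : ℕ) :
    ∃ (x : ℕ → List Bool) (b : ℕ → ℕ), (∀ n, (x n).length = n) ∧ (∀ n, c ≤ b n) ∧
      (∀ h : ℕ → ℕ, Computable h → ∃ᶠ n in atTop, (h n : ℕ∞) < U.logicalDepth (b n) (x n)) ∧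
      ∃ G : ℕ → ℕ, Computable G ∧ ∀ n, U.logicalDepth (b n + 1) (x n) ≤ G n := by
  obtain ⟨G₀, hG₀, hdrop⟩ := hU.exists_drop_one c
  obtain ⟨t, ht, hbound⟩ := hU.exists_computable_depth_bound
  let G : ℕ → ℕ := fun n => G₀ n + t n
  have hG : Computable G := Primrec.nat_add.to_comp.comp hG₀ ht
  -- These are the admissible levels for `x`. Depth decreases with the level, so the least
  -- admissible level gives the greatest depth; maximizing this over `x` beats the witness for every
  -- `h`.
  let B : ℕ → List Bool → Set ℕ := fun n x => {b | c ≤ b ∧ U.logicalDepth (b + 1) x ≤ G n}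
  have hmax : ∀ n, ∃ x : List Bool, (x.length = n ∧ (B n x).Nonempty) ∧
      ∀ y : List Bool, (y.length = n ∧ (B n y).Nonempty) →
        U.logicalDepth (sInf (B n y)) y ≤ U.logicalDepth (sInf (B n x)) x := by
    intro n
    refine Set.exists_max_image {x : List Bool | x.length = n ∧ (B n x).Nonempty}
      (fun x => U.logicalDepth (sInf (B n x)) x)
      ((List.finite_length_eq Bool n).subset fun x hx => hx.1) ?_
    obtain ⟨b, hb⟩ := hbound n
    refine ⟨List.replicate n false, by simp, max b c, le_max_right _ _, ?_⟩
    refine (hb _ (le_trans (le_max_left _ _) (Nat.le_succ _))).trans ?_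
    exact_mod_cast Nat.le_add_left _ _
  choose x hx hmax using hmax
  have hmem : ∀ n, sInf (B n (x n)) ∈ B n (x n) := fun n => Nat.sInf_mem (hx n).2
  refine ⟨x, fun n => sInf (B n (x n)), fun n => (hx n).1, fun n => (hmem n).1, fun h hh => ?_,
    G, hG, fun n => (hmem n).2⟩
  refine frequently_atTop.2 fun N => ?_
  obtain ⟨n, hn, y, b, hy, hb, h₁, h₂⟩ := hdrop h hh N
  have hbB : b ∈ B n y := ⟨hb, h₂.trans (by exact_mod_cast Nat.le_add_right _ _)⟩
  exact ⟨n, hn, h₁.trans_le ((logicalDepth_anti (Nat.sInf_le hbB) y).trans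
    (hmax n y ⟨hy, b, hbB⟩))⟩

end PrefixTM
theorem corollary2 (U : PrefixTM) (hU : U.IsOptimal) :
    ∃ (c : ℕ) (r : ℕ → ℕ),
      0 < c ∧
      ((fun n => (r n : ℝ)) =O[atTop] fun n => Real.logb 2 (n : ℝ)) ∧
      -- the inequalities `f(j) ≤ s*(j) ≤ BB(|x_j| + O(log |x_j|))`
      (∀ (x : ℕ → List Bool) (b : ℕ → ℕ), (∀ j, c ≤ b j) → ∀ j,
        U.logicalDepth (b j) (x j) ≤ U.shortestProgramTime (x j) ∧
        U.shortestProgramTime (x j) ≤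
          (U.busyBeaver ((x j).length + r (x j).length) : ℕ∞)) ∧
      -- a sequence for which `f`, hence `s*`, has no computable bound, whereas the depth
      -- at significance `b_j + 1` has one
      (∃ (x : ℕ → List Bool) (b : ℕ → ℕ),
        (∀ j, (x (j + 1)).length = (x j).length + 1) ∧
        (∀ j, c ≤ b j) ∧
        (∀ h : ℕ → ℕ, Computable h →
          ∃ᶠ j in atTop, (h j : ℕ∞) < U.logicalDepth (b j) (x j)) ∧
        (∃ G : ℕ → ℕ, Computable G ∧ ∀ j, U.logicalDepth (b j + 1) (x j) ≤ (G j : ℕ∞)) ∧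
        (∀ h : ℕ → ℕ, Computable h →
          ∃ᶠ j in atTop, (h j : ℕ∞) < U.shortestProgramTime (x j))) ∧
      -- a sequence for which `f`, hence `s*`, eventually exceeds every computable function
      (∃ (x : ℕ → List Bool) (b : ℕ → ℕ),
        (∀ j, (x (j + 1)).length = (x j).length + 1) ∧
        (∀ j, c ≤ b j) ∧
        (∀ h : ℕ → ℕ, Computable h →
          ∀ᶠ j in atTop, (h j : ℕ∞) < U.logicalDepth (b j) (x j)) ∧
        (∀ h : ℕ → ℕ, Computable h →
          ∀ᶠ j in atTop, (h j : ℕ∞) < U.shortestProgramTime (x j))) := by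
  obtain ⟨c, hc⟩ := hU.exists_logicalDepth_le_shortestProgramTime
  obtain ⟨r, hr, hK⟩ := hU.exists_complexity_bound
  obtain ⟨x, b, hx, hb, hdeep, hdrop⟩ := hU.exists_drop_sequence (c + 1)
  obtain ⟨y, hy, hy'⟩ := hU.exists_deep_sequence (c + 1)
  -- The successor only ensures that the constant is positive.
  refine ⟨c + 1, r, Nat.succ_pos c, hr, fun x b hb j => ⟨?_, ?_⟩,
    ⟨x, b, fun j => by rw [hx, hx], hb, hdeep, hdrop, fun h hh => ?_⟩,
    ⟨y, fun _ => c + 1, fun j => by rw [hy, hy], fun _ => le_rfl, hy', fun h hh => ?_⟩⟩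
  · exact hc _ _ ((Nat.le_succ c).trans (hb j))
  · exact hU.shortestProgramTime_le (hK _)
  · exact (hdeep h hh).mono fun j hj =>
      hj.trans_le (hc _ _ ((Nat.le_succ c).trans (hb j)))
  · exact (hy' h hh).mono fun j hj => hj.trans_le (hc _ _ (Nat.le_succ c))
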